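/- Let $f:\mathbb{R}^n\to\mathbb{R}$ be differentiable, with $f(x)\ge f_{\mathrm{low}}$ for all $x$ and $\|\nabla f(x)-\nabla f(y)\|\le L_1\|x-y\|$ for all $x,y$, where $L_1>0$. Let $G:\mathbb{R}^n\times\Xi\to\mathbb{R}^n$ be a (measurable) stochastic gradient estimator with $$\mathbb{E}[G(x;\xi)]=\nabla f(x),\qquad \mathbb{E}[\|G(x;\xi)-\nabla f(x)\|^\alpha]\le\sigma^\alpha\qquad\forall x\in\mathbb{R}^n$$ for some $\sigma>0$ and $\alpha\in(1,2]$. Suppose moreover that, for some integer $p\ge2$, $f$ is $p$ times continuously differentiable and its $p$-th derivative, in the operator norm of $p$-linear forms, is $L_p$-Lipschitz with $L_p>0$. Put $d=p(2\alpha-1)+\alpha-1$ and $q=p-1$. For $k\ge0$ and $1\le t\le p-1$ let $$\eta_k=\frac1{(k+4)^{(p\alpha+\alpha-1)/d}},\quad \gamma_k=\frac1{(k+4)^{p\alpha/d}},\quad \gamma_{k,t}=\frac{\gamma_k}{t^2},\quad \theta_{k,t}=\frac{\prod_{1\le s\le p-1,\,s\ne t}(1-s^2/\gamma_k)}{(t^2/\gamma_k)\prod_{1\le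 s\le p-1,\,s\ne t}((t^2-s^2)/\gamma_k)}.$$ Given $x^0\in\mathbb{R}^n$, set $x^{-1}=x^0$, $m^{-1}=0$, $\gamma_{-1,t}=1$, $\theta_{-1,t}=1/q$, and consider the normalized method with multi-extrapolated momentum: for $k=0,1,2,\dots$, $$z^{k,t}=x^k+\frac{1-\gamma_{k-1,t}}{\gamma_{k-1,t}}(x^k-x^{k-1})\quad(1\le t\le q),$$ $$m^k=\Big(1-\sum_{t=1}^q\theta_{k-1,t}\Big)m^{k-1}+\sum_{t=1}^q\theta_{k-1,t}\,G(z^{k,t};\xi^{k,t}),\qquad x^{k+1}=x^k-\eta_k\frac{m^k}{\|m^k\|}$$ (with $x^{k+1}=x^k$ if $m^k=0$). Here every $\xi^{k,t}$ has the law of $\xi$ and the families $(\xi^{k,t})_t$, $k\ge0$, are independent of each other; within one iteration any joint law is allowed, for instance one common sample $\xi^{k,t}=\xi^k$ for all $t$, or independent samples. Then these parameters are admissible, that is, $\eta_k>0$, $\gamma_{k,t}\in(0,1)$ and $\sum_{t=1}^{q}\theta_{k,t}\in(0,1)$, and the weights solve the Vandermonde systems $\sum_{t=1}^{q}\theta_{k,t}/\gamma_{k,t}^{\,r}=1$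 for $1\le r\le q$, for all $k\ge 0$. Moreover, with $$M_{p,\alpha}=4\Big(f(x^0)-f_{\mathrm{low}}+4^{1/3}\sigma^\alpha+\frac{L_1}2+30^{1/(\alpha-1)}(\alpha-1)\Big(\frac2\alpha\Big)^{\alpha/(\alpha-1)}+\frac{306\,p^{2\alpha p}L_p^\alpha}{(p!)^\alpha}+64(p-1)^\alpha\sigma^\alpha\Big),$$ for every $\epsilon\in(0,1)$ and every integer $$K\ge\max\Big\{\Big(\frac{2d\,M_{p,\alpha}}{p(\alpha-1)\epsilon}\ln\Big(\frac{2d\,M_{p,\alpha}}{p(\alpha-1)\epsilon}\Big)\Big)^{d/(p(\alpha-1))},\,5\Big\},$$ it holds that $\mathbb{E}[\|\nabla f(x^{\iota_K})\|]\le\epsilon$, where $\iota_K$ is drawn uniformly from $\{0,\dots,K-1\}$, independently of the samples. -/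

import Mathlib

open MeasureTheory ProbabilityTheory

noncomputable section

/-- Standing assumptions: `f` is differentiable and bounded below by `flow`, its gradient is
`L₁`-Lipschitz, and `G(x; ·)`, under the law `D` of the samples, is an unbiased estimator of
`∇ f x` whose `α`-th central moment is at most `σ ^ α`, where `α ∈ (1, 2]`. -/
structure BasicAssumption {n : ℕ} {Ξ : Type*} [MeasurableSpace Ξ]
    (f : EuclideanSpace ℝ (Fin n) → ℝ)
    (G : EuclideanSpace ℝ (Fin n) → Ξ → EuclideanSpace ℝ (Fin n))
    (D : Measure Ξ) (flow L₁ σ α : ℝ) : Prop where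
  differentiable : Differentiable ℝ f
  lower_bound : ∀ x, flow ≤ f x
  L₁_pos : 0 < L₁
  gradient_lipschitz : ∀ x y, ‖gradient f x - gradient f y‖ ≤ L₁ * ‖x - y‖
  σ_pos : 0 < σ
  α_gt_one : 1 < α
  α_le_two : α ≤ 2
  measurable_G : Measurable (Function.uncurry G)
  integrable_G : ∀ x, Integrable (G x) D
  unbiased : ∀ x, ∫ w, G x w ∂D = gradient f x
  integrable_moment : ∀ x, Integrable (fun w => ‖G x w - gradient f x‖ ^ α) D
  moment_le : ∀ x, ∫ w, ‖G x w - gradient f x‖ ^ α ∂D ≤ σ ^ α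

/-- High-order smoothness: `f` is `p` times continuously differentiable, with `p ≥ 2`, and its
`p`-th derivative, a symmetric `p`-linear form with the operator norm, is `Lp`-Lipschitz. -/
structure HighSmoothAssumption {n : ℕ} (f : EuclideanSpace ℝ (Fin n) → ℝ)
    (p : ℕ) (Lp : ℝ) : Prop where
  two_le : 2 ≤ p
  contDiff : ContDiff ℝ p f
  Lp_pos : 0 < Lp
  lipschitz : ∀ x y, ‖iteratedFDeriv ℝ p f x - iteratedFDeriv ℝ p f y‖ ≤ Lp * ‖x - y‖

/-- The quantities `(x^{k-1}, x^k, m^{k-1})` available at the start of iteration `k`. -/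
structure MemState (E : Type*) where
  xPrev : E
  x : E
  mPrev : E

/-- The extrapolation parameters `γ_{k-1,t}`, with the convention `γ_{-1,t} = 1`. -/
def memPrevGamma (γ : ℕ → ℕ → ℝ) : ℕ → ℕ → ℝ
  | 0, _ => 1
  | k + 1, t => γ k t

/-- The weighting parameters `θ_{k-1,t}`, with the convention `θ_{-1,t} = 1 / q`. -/
def memPrevTheta (q : ℕ) (θ : ℕ → ℕ → ℝ) : ℕ → ℕ → ℝ
  | 0, _ => 1 / (q : ℝ)
  | k + 1, t => θ k t

section Algorithm

variable {E : Type*} [NormedAddCommGroup E] [NormedSpace ℝ E] {Ξ : Type*}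

/-- The extrapolated point `z^{k,t} = x^k + ((1 - γ_{k-1,t}) / γ_{k-1,t}) (x^k - x^{k-1})`. -/
def memZ (γ : ℕ → ℕ → ℝ) (k t : ℕ) (s : MemState E) : E :=
  s.x + ((1 - memPrevGamma γ k t) / memPrevGamma γ k t) • (s.x - s.xPrev)

/-- The search direction
`m^k = (1 - ∑_t θ_{k-1,t}) m^{k-1} + ∑_t θ_{k-1,t} G(z^{k,t}; w_t)`, where `w t` is the sample at
which the `t`-th stochastic gradient of iteration `k` is evaluated. -/
def memDir (G : E → Ξ → E) (q : ℕ) (γ θ : ℕ → ℕ → ℝ) (k : ℕ) (w : ℕ → Ξ) (s : MemState E) : E :=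
  (1 - ∑ t ∈ Finset.Icc 1 q, memPrevTheta q θ k t) • s.mPrev
    + ∑ t ∈ Finset.Icc 1 q, memPrevTheta q θ k t • G (memZ γ k t s) (w t)

/-- Iteration `k`: the new iterate is `x^{k+1} = x^k - η_k m^k / ‖m^k‖` (and `x^{k+1} = x^k` if
`m^k = 0`). -/
def memStep (G : E → Ξ → E) (q : ℕ) (η : ℕ → ℝ) (γ θ : ℕ → ℕ → ℝ) (k : ℕ) (w : ℕ → Ξ)
    (s : MemState E) : MemState E where
  xPrev := s.x
  x := s.x - (η k / ‖memDir G q γ θ k w s‖) • memDir G q γ θ k w s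
  mPrev := memDir G q γ θ k w s

/-- The normalized first-order method with multi-extrapolated momentum, run from `x0` (with
`x^{-1} = x^0`, `m^{-1} = 0`) on the samples `w k t`, `k ≥ 0`, `1 ≤ t ≤ q`. -/
def memRun (G : E → Ξ → E) (x0 : E) (q : ℕ) (η : ℕ → ℝ) (γ θ : ℕ → ℕ → ℝ) (w : ℕ → ℕ → Ξ) :
    ℕ → MemState E
  | 0 => ⟨x0, x0, 0⟩
  | k + 1 => memStep G q η γ θ k (w k) (memRun G x0 q η γ θ w k)

/-- The iterate `x^k` of the method. -/
def memIterate (G : E → Ξ → E) (x0 : E) (q : ℕ) (η : ℕ → ℝ) (γ θ : ℕ → ℕ → ℝ) (w : ℕ → ℕ → Ξ)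
    (k : ℕ) : E :=
  (memRun G x0 q η γ θ w k).x

end Algorithm

/-- The requirements that the method places on its input parameters. -/
structure MemAdmissible (q : ℕ) (η : ℕ → ℝ) (γ θ : ℕ → ℕ → ℝ) : Prop where
  one_le : 1 ≤ q
  η_pos : ∀ k, 0 < η k
  γ_mem : ∀ k, ∀ t ∈ Finset.Icc 1 q, γ k t ∈ Set.Ioo (0 : ℝ) 1
  θ_sum_mem : ∀ k, ∑ t ∈ Finset.Icc 1 q, θ k t ∈ Set.Ioo (0 : ℝ) 1

/-- The Vandermonde systems `∑_t θ_{k,t} / γ_{k,t}^r = 1`, `1 ≤ r ≤ q`. -/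
def SolvesVandermonde (q : ℕ) (γ θ : ℕ → ℕ → ℝ) : Prop :=
  ∀ k, ∀ r ∈ Finset.Icc 1 q, ∑ t ∈ Finset.Icc 1 q, (1 / γ k t ^ r) * θ k t = 1

/-- `p (2 α - 1) + α - 1`, the common denominator of the exponents. -/
def memDen (p : ℕ) (α : ℝ) : ℝ := p * (2 * α - 1) + α - 1

/-- The step sizes `η_k`. -/
def memEta (p : ℕ) (α : ℝ) (k : ℕ) : ℝ :=
  1 / ((k : ℝ) + 4) ^ ((p * α + α - 1) / memDen p α)

/-- The base extrapolation parameters `γ_k`. -/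
def memBaseGamma (p : ℕ) (α : ℝ) (k : ℕ) : ℝ :=
  1 / ((k : ℝ) + 4) ^ (p * α / memDen p α)

/-- The extrapolation parameters `γ_{k,t} = γ_k / t²`. -/
def memGamma (p : ℕ) (α : ℝ) (k t : ℕ) : ℝ :=
  memBaseGamma p α k / (t : ℝ) ^ 2

/-- The weighting parameters `θ_{k,t}`. -/
def memTheta (p : ℕ) (α : ℝ) (k t : ℕ) : ℝ :=
  (∏ s ∈ (Finset.Icc 1 (p - 1)).erase t, (1 - (s : ℝ) ^ 2 / memBaseGamma p α k)) /
    (((t : ℝ) ^ 2 / memBaseGamma p α k) *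
      ∏ s ∈ (Finset.Icc 1 (p - 1)).erase t,
        (((t : ℝ) ^ 2 - (s : ℝ) ^ 2) / memBaseGamma p α k))

/-- The constant `M_{p,α}`; `Δ` stands for the initial gap `f(x^0) - f_low`. -/
def memConst (p : ℕ) (α σ L₁ Lp Δ : ℝ) : ℝ :=
  4 * (Δ + (4 : ℝ) ^ (1 / 3 : ℝ) * σ ^ α + L₁ / 2
    + (30 : ℝ) ^ (1 / (α - 1)) * (α - 1) * (2 / α) ^ (α / (α - 1))
    + 306 * (p : ℝ) ^ (2 * α * p) * Lp ^ α / (p.factorial : ℝ) ^ α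
    + 64 * ((p : ℝ) - 1) ^ α * σ ^ α)

/-- The lower bound on the number of iterations `K`. -/
def memBound (p : ℕ) (α M ε : ℝ) : ℝ :=
  max ((2 * memDen p α * M / (p * (α - 1) * ε)
      * Real.log (2 * memDen p α * M / (p * (α - 1) * ε))) ^ (memDen p α / (p * (α - 1)))) 5

end

/-! The method tracks `∇ f(x^k)` by the momentum `m^k`, and a normalized step decreases `f` by
`η_k ‖∇ f(x^k)‖` up to the momentum error `e^k = m^k - ∇ f(x^k)` (`normalized_step_le`). The work
lies in the `α`-th moment of `e^k`.

The weight `θ_{k,t}` is the value at `γ_k` of the Lagrange basis polynomial of the node `t²` for the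
nodes `0, 1, 4, …, q²` (`extrapWeight_eq_basis`). Since interpolation reproduces monomials, the
weights solve the Vandermonde system, and `1 - ∑_t θ_{k,t} = ∏_t (1 - γ_k / t²)` lies in
`(0, 1 - γ_k]`. The Lagrange products at `0` are at most `2` (`abs_extrapWeight_le`), so
`|θ_{k,t}| ≤ 2 γ_k / t²`.

Because of the Vandermonde system, extrapolation cancels every Taylor term of `∇ f` of degree
`1, …, p - 1` (`norm_extrapolation_bias_le`), and `e^{k+1}` is `(1 - ∑_t θ_{k,t}) e^k` plus a bias
of order `η_k ^ p / γ_k ^ (p - 1)` plus centred noise with `α`-th moment of order `γ_k ^ α`. The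
inequality `norm_add_rpow_le` replaces the orthogonality that is available for `α = 2`: its linear
term integrates to zero because the new samples are independent of the past. This gives
`E‖e^{k+1}‖ ^ α ≤ (1 - γ_k) E‖e^k‖ ^ α + bias + noise` (`memErr_succ_moment`).

The exponents of the schedule, and of the weights `potWeight`, are such that weighted bias, weighted
noise and the Young constant that converts `2 η_k ‖e^k‖` into `‖e^k‖ ^ α` are all multiples of
`1 / (k + 4)`. Summing therefore costs a factor `log K`
(`sum_memEta_mul_integral_norm_gradient_le_memConst`), and `K η_{K-1} ≥ K ^ β / 2` with
`β = p (α - 1) / d` turns the weighted sum into the rate `M log K / K ^ β`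
(`average_integral_norm_gradient_le`), which the bound on `K` makes at most `ε`. -/

/-! ### Extrapolation weights as Lagrange basis polynomials -/

/-- The weight `∏_{s ≠ t} (1 - s² / c) / ((t² / c) ∏_{s ≠ t} ((t² - s²) / c))`, with `s` ranging
over `{1, …, q}`, as a function of the base parameter `c`. -/
noncomputable def extrapWeight (q : ℕ) (c : ℝ) (t : ℕ) : ℝ :=
  (∏ s ∈ (Finset.Icc 1 q).erase t, (1 - (s : ℝ) ^ 2 / c)) /
    (((t : ℝ) ^ 2 / c) *
      ∏ s ∈ (Finset.Icc 1 q).erase t, (((t : ℝ) ^ 2 - (s : ℝ) ^ 2) / c))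

lemma extrapWeight_eq (q : ℕ) {c : ℝ} (hc : c ≠ 0) (t : ℕ) :
    extrapWeight q c t = c / (t : ℝ) ^ 2 *
      ∏ s ∈ (Finset.Icc 1 q).erase t, ((c - (s : ℝ) ^ 2) / ((t : ℝ) ^ 2 - (s : ℝ) ^ 2)) := by
  have h : ∀ s : ℕ, (c - (s : ℝ) ^ 2) / ((t : ℝ) ^ 2 - (s : ℝ) ^ 2)
      = (1 - (s : ℝ) ^ 2 / c) / (((t : ℝ) ^ 2 - (s : ℝ) ^ 2) / c) := fun s => by
    rw [div_div_eq_mul_div, sub_mul, div_mul_cancel₀ _ hc, one_mul]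
  simp_rw [h]
  rw [Finset.prod_div_distrib, extrapWeight, div_mul_eq_div_div_swap, div_div_eq_mul_div,
    mul_div_assoc, mul_comm]

lemma sq_cast_injOn (s : Set ℕ) : Set.InjOn (fun t : ℕ => (t : ℝ) ^ 2) s := fun a _ b _ h => by
  have := (pow_left_inj₀ (Nat.cast_nonneg (α := ℝ) a) (Nat.cast_nonneg b) two_ne_zero).1 h
  exact_mod_cast this

/-- For `t ≥ 1` the weight is the value at `c` of the Lagrange basis polynomial of the node `t²`
in the node set `0, 1, 4, …, q²`. -/
lemma extrapWeight_eq_basis (q : ℕ) {c : ℝ} (hc : c ≠ 0) {t : ℕ} (ht : t ∈ Finset.Icc 1 q) :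
    extrapWeight q c t =
      (Lagrange.basis (Finset.range (q + 1)) (fun t : ℕ => (t : ℝ) ^ 2) t).eval c := by
  have h0 : (Finset.range (q + 1)).erase t = insert 0 ((Finset.Icc 1 q).erase t) := by
    ext s
    simp only [Finset.mem_erase, Finset.mem_range, Finset.mem_insert, Finset.mem_Icc] at ht ⊢
    omega
  rw [extrapWeight_eq q hc, Lagrange.basis, h0, Finset.prod_insert (by simp),
    Polynomial.eval_mul, Polynomial.eval_prod]
  congr 1
  · simp [Lagrange.basisDivisor, div_eq_inv_mul]
  · refine Finset.prod_congr rfl fun s _ => ?_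
    simp [Lagrange.basisDivisor, div_eq_inv_mul]

lemma basis_zero_eval (q : ℕ) (c : ℝ) :
    (Lagrange.basis (Finset.range (q + 1)) (fun t : ℕ => (t : ℝ) ^ 2) 0).eval c
      = ∏ t ∈ Finset.Icc 1 q, (1 - c / (t : ℝ) ^ 2) := by
  have h0 : (Finset.range (q + 1)).erase 0 = Finset.Icc 1 q := by
    ext s
    simp only [Finset.mem_erase, Finset.mem_range, Finset.mem_Icc]
    omega
  rw [Lagrange.basis, h0, Polynomial.eval_prod]
  refine Finset.prod_congr rfl fun s hs => ?_
  have : (s : ℝ) ≠ 0 := by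
    have := (Finset.mem_Icc.1 hs).1
    positivity
  simp [Lagrange.basisDivisor]
  field_simp
  ring

/-- Lagrange interpolation reproduces monomials of degree at most `q` at the nodes
`0, 1, 4, …, q²`. -/
lemma sum_basis_mul_pow (q : ℕ) (c : ℝ) {r : ℕ} (hr : r ≤ q) :
    ∑ t ∈ Finset.range (q + 1),
      (Lagrange.basis (Finset.range (q + 1)) (fun t : ℕ => (t : ℝ) ^ 2) t).eval c
        * ((t : ℝ) ^ 2) ^ r = c ^ r := by
  have h := Lagrange.eq_interpolate_of_eval_eq (f := (Polynomial.X : Polynomial ℝ) ^ r)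
    (s := Finset.range (q + 1)) (v := fun t : ℕ => (t : ℝ) ^ 2)
    (fun t : ℕ => ((t : ℝ) ^ 2) ^ r) (sq_cast_injOn _)
    (by
      rw [Polynomial.degree_X_pow, Finset.card_range]
      exact_mod_cast Nat.lt_succ_of_le hr)
    (fun i _ => by simp)
  have h2 := congrArg (Polynomial.eval c) h
  rw [Lagrange.interpolate_apply, Polynomial.eval_finsetSum] at h2
  simp only [Polynomial.eval_pow, Polynomial.eval_X, Polynomial.eval_mul,
    Polynomial.eval_C] at h2
  rw [h2]
  exact Finset.sum_congr rfl fun t _ => mul_comm _ _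

lemma range_succ_eq_insert_Icc (q : ℕ) : Finset.range (q + 1) = insert 0 (Finset.Icc 1 q) := by
  ext s
  simp only [Finset.mem_range, Finset.mem_insert, Finset.mem_Icc]
  omega

/-- The weights solve the Vandermonde system. -/
lemma sum_extrapWeight_mul_pow (q : ℕ) {c : ℝ} (hc : c ≠ 0) {r : ℕ} (hr : r ∈ Finset.Icc 1 q) :
    ∑ t ∈ Finset.Icc 1 q, extrapWeight q c t * ((t : ℝ) ^ 2 / c) ^ r = 1 := by
  obtain ⟨hr1, hrq⟩ := Finset.mem_Icc.1 hr
  have h := sum_basis_mul_pow q c hrq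
  rw [range_succ_eq_insert_Icc, Finset.sum_insert (by simp), ← range_succ_eq_insert_Icc] at h
  rw [Nat.cast_zero, zero_pow two_ne_zero, zero_pow (by omega), mul_zero, zero_add] at h
  rw [← div_self (pow_ne_zero r hc), ← h, Finset.sum_div]
  refine Finset.sum_congr rfl fun t ht => ?_
  rw [extrapWeight_eq_basis q hc ht, div_pow, mul_div_assoc, h]

lemma sum_extrapWeight (q : ℕ) {c : ℝ} (hc : c ≠ 0) :
    ∑ t ∈ Finset.Icc 1 q, extrapWeight q c t = 1 - ∏ t ∈ Finset.Icc 1 q, (1 - c / (t : ℝ) ^ 2) := by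
  have h := sum_basis_mul_pow q c (Nat.zero_le q)
  rw [range_succ_eq_insert_Icc, Finset.sum_insert (by simp), ← range_succ_eq_insert_Icc] at h
  simp only [pow_zero, mul_one] at h
  rw [basis_zero_eval] at h
  rw [Finset.sum_congr rfl fun t ht => extrapWeight_eq_basis q hc ht]
  linarith

lemma one_sub_div_sq_mem {c : ℝ} (hc0 : 0 < c) (hc1 : c < 1) {t : ℕ} (ht : 1 ≤ t) :
    0 < 1 - c / (t : ℝ) ^ 2 ∧ 1 - c / (t : ℝ) ^ 2 ≤ 1 := by
  have h1 : (1 : ℝ) ≤ (t : ℝ) ^ 2 := one_le_pow₀ (by exact_mod_cast ht)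
  have h2 : c / (t : ℝ) ^ 2 < 1 := (div_lt_one (by linarith)).2 (by linarith)
  have h3 : 0 ≤ c / (t : ℝ) ^ 2 := by positivity
  constructor <;> linarith

lemma sum_extrapWeight_lt_one (q : ℕ) {c : ℝ} (hc0 : 0 < c) (hc1 : c < 1) :
    ∑ t ∈ Finset.Icc 1 q, extrapWeight q c t < 1 := by
  rw [sum_extrapWeight q hc0.ne']
  have : 0 < ∏ t ∈ Finset.Icc 1 q, (1 - c / (t : ℝ) ^ 2) :=
    Finset.prod_pos fun t ht => (one_sub_div_sq_mem hc0 hc1 (Finset.mem_Icc.1 ht).1).1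
  linarith

lemma le_sum_extrapWeight {q : ℕ} (hq : 1 ≤ q) {c : ℝ} (hc0 : 0 < c) (hc1 : c < 1) :
    c ≤ ∑ t ∈ Finset.Icc 1 q, extrapWeight q c t := by
  rw [sum_extrapWeight q hc0.ne', ← Finset.mul_prod_erase _ _ (Finset.mem_Icc.2 ⟨le_rfl, hq⟩)]
  have h : ∏ t ∈ (Finset.Icc 1 q).erase 1, (1 - c / (t : ℝ) ^ 2) ≤ 1 :=
    Finset.prod_le_one
      (fun t ht => (one_sub_div_sq_mem hc0 hc1
        (Finset.mem_Icc.1 (Finset.mem_of_mem_erase ht)).1).1.le)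
      (fun t ht => (one_sub_div_sq_mem hc0 hc1
        (Finset.mem_Icc.1 (Finset.mem_of_mem_erase ht)).1).2)
  have := mul_le_mul_of_nonneg_left h (sub_nonneg.2 hc1.le)
  simp only [Nat.cast_one, one_pow, div_one]
  linarith

lemma prod_sq_sub_sq_below {t m : ℕ} (hm : m < t) :
    (∏ s ∈ Finset.Icc 1 m, |(t : ℝ) ^ 2 - (s : ℝ) ^ 2|) * t * ((t - 1 - m).factorial : ℝ)
      = ((t + m).factorial : ℝ) := by
  induction m with
  | zero =>
    obtain ⟨u, rfl⟩ : ∃ u, t = u + 1 := ⟨t - 1, by omega⟩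
    simp [Nat.factorial_succ]
  | succ m ih =>
    obtain ⟨u, rfl⟩ : ∃ u, t = m + 2 + u := ⟨t - m - 2, by omega⟩
    have ih := ih (by omega)
    rw [Finset.prod_Icc_succ_top (by omega)]
    have e1 : m + 2 + u - 1 - m = u + 1 := by omega
    have e2 : m + 2 + u - 1 - (m + 1) = u := by omega
    rw [e1, Nat.factorial_succ] at ih
    rw [e2, ← add_assoc (m + 2 + u) m 1, Nat.factorial_succ]
    have h : |((m + 2 + u : ℕ) : ℝ) ^ 2 - ((m + 1 : ℕ) : ℝ) ^ 2|
        = (u + 1) * ((m + 2 + u) + m + 1) := by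
      rw [show ((m + 2 + u : ℕ) : ℝ) ^ 2 - ((m + 1 : ℕ) : ℝ) ^ 2
        = (u + 1) * ((m + 2 + u) + m + 1) by push_cast; ring]
      exact abs_of_nonneg (by positivity)
    rw [h]
    push_cast at ih ⊢
    rw [← ih]
    ring

lemma prod_abs_sq_sub_sq {t q : ℕ} (ht : 1 ≤ t) (hq : t ≤ q) :
    (∏ s ∈ (Finset.Icc 1 q).erase t, |(t : ℝ) ^ 2 - (s : ℝ) ^ 2|) * (2 * (t : ℝ) ^ 2)
      = ((q - t).factorial : ℝ) * ((q + t).factorial : ℝ) := by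
  induction q, hq using Nat.le_induction with
  | base =>
    obtain ⟨m, rfl⟩ : ∃ m, t = m + 1 := ⟨t - 1, by omega⟩
    have h := prod_sq_sub_sq_below (Nat.lt_succ_self m)
    have e : (Finset.Icc 1 (m + 1)).erase (m + 1) = Finset.Icc 1 m := by
      ext s
      simp only [Finset.mem_erase, Finset.mem_Icc]
      omega
    rw [e, Nat.sub_self, ← add_assoc (m + 1) m 1, Nat.factorial_succ (m + 1 + m)]
    simp only [Nat.succ_eq_add_one, Nat.add_sub_cancel, Nat.sub_self, Nat.factorial_zero] at h ⊢
    push_cast at h ⊢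
    rw [← h]
    ring
  | succ q hq ih =>
    have e : (Finset.Icc 1 (q + 1)).erase t = insert (q + 1) ((Finset.Icc 1 q).erase t) := by
      ext s
      simp only [Finset.mem_erase, Finset.mem_Icc, Finset.mem_insert]
      omega
    rw [e, Finset.prod_insert (by simp), mul_assoc, ih]
    obtain ⟨u, rfl⟩ : ∃ u, q = t + u := ⟨q - t, by omega⟩
    have e1 : t + u + 1 - t = u + 1 := by omega
    have e2 : t + u - t = u := by omega
    have e3 : t + u + 1 + t = t + u + t + 1 := by omega
    rw [e1, e2, e3, Nat.factorial_succ, Nat.factorial_succ]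
    have h : |(t : ℝ) ^ 2 - ((t + u + 1 : ℕ) : ℝ) ^ 2| = (u + 1) * (t + u + t + 1) := by
      rw [abs_sub_comm, show ((t + u + 1 : ℕ) : ℝ) ^ 2 - (t : ℝ) ^ 2
        = (u + 1) * (t + u + t + 1) by push_cast; ring]
      exact abs_of_nonneg (by positivity)
    rw [h]
    push_cast
    ring

lemma prod_sq_erase {t q : ℕ} (ht : t ∈ Finset.Icc 1 q) :
    (∏ s ∈ (Finset.Icc 1 q).erase t, (s : ℝ) ^ 2) * (t : ℝ) ^ 2 = (q.factorial : ℝ) ^ 2 := by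
  rw [Finset.prod_erase_mul _ _ ht, Finset.prod_pow]
  congr 1
  clear ht
  induction q with
  | zero => simp
  | succ q ih =>
    rw [Finset.prod_Icc_succ_top (by omega), ih, Nat.factorial_succ]
    push_cast
    ring

lemma factorial_sq_le {t q : ℕ} (hq : t ≤ q) :
    (q.factorial : ℝ) ^ 2 ≤ ((q - t).factorial : ℝ) * ((q + t).factorial : ℝ) := by
  induction t with
  | zero => simp [sq]
  | succ t ih =>
    refine (ih (by omega)).trans ?_
    obtain ⟨u, rfl⟩ : ∃ u, q = t + 1 + u := ⟨q - t - 1, by omega⟩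
    have e1 : t + 1 + u - t = u + 1 := by omega
    have e2 : t + 1 + u - (t + 1) = u := by omega
    rw [e1, e2, ← add_assoc (t + 1 + u) t 1, Nat.factorial_succ, Nat.factorial_succ]
    have : u + 1 ≤ t + 1 + u + t + 1 := by omega
    have h2 : ((u + 1 : ℕ) : ℝ) ≤ ((t + 1 + u + t + 1 : ℕ) : ℝ) := by exact_mod_cast this
    rw [Nat.cast_mul, Nat.cast_mul]
    nlinarith [mul_nonneg (Nat.cast_nonneg (α := ℝ) u.factorial)
      (Nat.cast_nonneg (α := ℝ) (t + 1 + u + t).factorial)]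

/-- The Lagrange products at `0` telescope to `2 (q!)² / ((q - t)! (q + t)!) ≤ 2`, and moving the
evaluation point from `0` to `c ∈ (0, 1)` only decreases them. -/
lemma abs_extrapWeight_le {q : ℕ} {c : ℝ} (hc0 : 0 < c) (hc1 : c < 1) {t : ℕ}
    (ht : t ∈ Finset.Icc 1 q) : |extrapWeight q c t| ≤ 2 * (c / (t : ℝ) ^ 2) := by
  obtain ⟨ht1, htq⟩ := Finset.mem_Icc.1 ht
  have htp : (0 : ℝ) < (t : ℝ) ^ 2 := by positivity
  rw [extrapWeight_eq q hc0.ne', abs_mul, abs_of_pos (div_pos hc0 htp), mul_comm,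
    Finset.abs_prod]
  refine mul_le_mul_of_nonneg_right ?_ (div_pos hc0 htp).le
  have hne : ∀ s ∈ (Finset.Icc 1 q).erase t, 0 < |(t : ℝ) ^ 2 - (s : ℝ) ^ 2| := fun s hs =>
    abs_pos.2 (sub_ne_zero.2 fun h => (Finset.mem_erase.1 hs).1
      (sq_cast_injOn Set.univ (Set.mem_univ _) (Set.mem_univ _) h.symm))
  calc ∏ s ∈ (Finset.Icc 1 q).erase t, |(c - (s : ℝ) ^ 2) / ((t : ℝ) ^ 2 - (s : ℝ) ^ 2)|
      ≤ ∏ s ∈ (Finset.Icc 1 q).erase t, (s : ℝ) ^ 2 / |(t : ℝ) ^ 2 - (s : ℝ) ^ 2| := by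
        refine Finset.prod_le_prod (fun _ _ => abs_nonneg _) fun s hs => ?_
        rw [abs_div]
        refine div_le_div_of_nonneg_right ?_ (abs_nonneg _)
        have hs1 : (1 : ℝ) ≤ (s : ℝ) ^ 2 := one_le_pow₀
          (by exact_mod_cast (Finset.mem_Icc.1 (Finset.mem_of_mem_erase hs)).1)
        rw [abs_le]
        constructor <;> linarith
    _ ≤ 2 := by
        rw [Finset.prod_div_distrib, div_le_iff₀ (Finset.prod_pos hne)]
        have h1 := prod_abs_sq_sub_sq ht1 htq
        have h2 := prod_sq_erase ht
        have h3 := factorial_sq_le htq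
        rw [← h1, ← h2] at h3
        refine le_of_mul_le_mul_right ?_ htp
        linarith

lemma abs_extrapWeight_le_two_mul {q : ℕ} {c : ℝ} (hc0 : 0 < c) (hc1 : c < 1) {t : ℕ}
    (ht : t ∈ Finset.Icc 1 q) : |extrapWeight q c t| ≤ 2 * c := by
  refine (abs_extrapWeight_le hc0 hc1 ht).trans ?_
  have : (1 : ℝ) ≤ (t : ℝ) ^ 2 := one_le_pow₀ (by exact_mod_cast (Finset.mem_Icc.1 ht).1)
  have := div_le_self hc0.le this
  linarith

/-- The amplification `1 + ∑_t |θ_t| (t² / c)^{q + 1}` of the Taylor remainders. -/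
lemma one_add_sum_abs_extrapWeight_mul_pow_le {q : ℕ} {c : ℝ} (hc0 : 0 < c) (hc1 : c < 1) :
    1 + ∑ t ∈ Finset.Icc 1 q, |extrapWeight q c t| * ((t : ℝ) ^ 2 / c) ^ (q + 1)
      ≤ 2 * ((q : ℝ) + 1) ^ (2 * q + 1) / c ^ q := by
  have hcq : 0 < c ^ q := pow_pos hc0 q
  have h1 : ∀ t ∈ Finset.Icc 1 q, |extrapWeight q c t| * ((t : ℝ) ^ 2 / c) ^ (q + 1)
      ≤ 2 * (q : ℝ) ^ (2 * q) / c ^ q := fun t ht => by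
    obtain ⟨ht1, htq⟩ := Finset.mem_Icc.1 ht
    have htp : (0 : ℝ) < (t : ℝ) := by exact_mod_cast ht1
    calc |extrapWeight q c t| * ((t : ℝ) ^ 2 / c) ^ (q + 1)
        ≤ 2 * (c / (t : ℝ) ^ 2) * ((t : ℝ) ^ 2 / c) ^ (q + 1) :=
          mul_le_mul_of_nonneg_right (abs_extrapWeight_le hc0 hc1 ht) (by positivity)
      _ = 2 * (t : ℝ) ^ (2 * q) / c ^ q := by
          have ht2 : (t : ℝ) ^ 2 ≠ 0 := by positivity
          rw [div_pow, pow_succ ((t : ℝ) ^ 2) q, pow_succ c q, pow_mul]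
          field_simp
      _ ≤ 2 * (q : ℝ) ^ (2 * q) / c ^ q := by
          have : (t : ℝ) ≤ q := by exact_mod_cast htq
          gcongr
  have h2 : ∑ t ∈ Finset.Icc 1 q, |extrapWeight q c t| * ((t : ℝ) ^ 2 / c) ^ (q + 1)
      ≤ 2 * (q : ℝ) ^ (2 * q + 1) / c ^ q := by
    refine (Finset.sum_le_sum h1).trans (le_of_eq ?_)
    rw [Finset.sum_const, Nat.card_Icc, nsmul_eq_mul, Nat.add_sub_cancel, pow_succ]
    ring
  have h3 : (1 : ℝ) ≤ 1 / c ^ q := (one_le_div hcq).2 (pow_le_one₀ hc0.le hc1.le)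
  have h4 : (q : ℝ) ^ (2 * q + 1) + 1 ≤ ((q : ℝ) + 1) ^ (2 * q + 1) := by
    have := pow_add_pow_le (Nat.cast_nonneg (α := ℝ) q) zero_le_one (n := 2 * q + 1) (by omega)
    simpa using this
  calc 1 + ∑ t ∈ Finset.Icc 1 q, |extrapWeight q c t| * ((t : ℝ) ^ 2 / c) ^ (q + 1)
      ≤ 2 * (1 / c ^ q) + 2 * (q : ℝ) ^ (2 * q + 1) / c ^ q := by linarith
    _ = 2 * ((q : ℝ) ^ (2 * q + 1) + 1) / c ^ q := by ring
    _ ≤ _ := by gcongr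

/-! ### Smoothness: descent and Taylor estimates -/

section Smooth

variable {E : Type*} [NormedAddCommGroup E] [InnerProductSpace ℝ E] [CompleteSpace E]

lemma le_of_gradient_lipschitz {f : E → ℝ} (hd : Differentiable ℝ f) {L : ℝ}
    (hL : ∀ x y, ‖gradient f x - gradient f y‖ ≤ L * ‖x - y‖) (x v : E) :
    f (x + v) ≤ f x + inner ℝ (gradient f x) v + L / 2 * ‖v‖ ^ 2 := by
  set h : ℝ → ℝ := fun s => f (x + s • v) - s * inner ℝ (gradient f x) v - L / 2 * s ^ 2 * ‖v‖ ^ 2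
  have hder : ∀ s, HasDerivAt h (inner ℝ (gradient f (x + s • v)) v - inner ℝ (gradient f x) v
      - L * s * ‖v‖ ^ 2) s := fun s => by
    have h1 : HasDerivAt (fun s : ℝ => x + s • v) v s := by
      simpa using ((hasDerivAt_id s).smul_const v).const_add x
    have h2 := (hd (x + s • v)).hasFDerivAt.comp_hasDerivAt s h1
    rw [← inner_gradient_left] at h2
    have h3 := (hasDerivAt_id s).mul_const (inner ℝ (gradient f x) v)
    have h4 := (((hasDerivAt_id s).pow 2).const_mul (L / 2)).mul_const (‖v‖ ^ 2)
    refine ((h2.sub h3).sub h4).congr_deriv ?_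
    simp only [id]
    ring
  have hanti : AntitoneOn h (Set.Icc 0 1) := by
    refine antitoneOn_of_deriv_nonpos (convex_Icc 0 1)
      (fun s _ => (hder s).continuousAt.continuousWithinAt)
      (fun s _ => (hder s).differentiableAt.differentiableWithinAt) fun s hs => ?_
    rw [interior_Icc] at hs
    rw [(hder s).deriv, ← inner_sub_left]
    have h5 := real_inner_le_norm (gradient f (x + s • v) - gradient f x) v
    have h6 := hL (x + s • v) x
    rw [add_sub_cancel_left, norm_smul, Real.norm_of_nonneg hs.1.le] at h6
    nlinarith [mul_le_mul_of_nonneg_right h6 (norm_nonneg v)]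
  have := hanti (Set.left_mem_Icc.2 zero_le_one) (Set.right_mem_Icc.2 zero_le_one) zero_le_one
  simp only [h, zero_smul, one_smul, add_zero, zero_mul, one_mul, one_pow, mul_one] at this
  rw [zero_pow two_ne_zero, mul_zero, zero_mul, sub_zero, sub_zero] at this
  linarith

/-- Decrease of `f` along a normalized step in direction `m`. The step is `0` if `m = 0`. -/
lemma normalized_step_le {f : E → ℝ} (hd : Differentiable ℝ f) {L : ℝ} (hL0 : 0 ≤ L)
    (hL : ∀ x y, ‖gradient f x - gradient f y‖ ≤ L * ‖x - y‖) (x m : E) {η : ℝ} (hη : 0 ≤ η) :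
    f (x - (η / ‖m‖) • m) ≤
      f x - η * ‖gradient f x‖ + 2 * η * ‖m - gradient f x‖ + L / 2 * η ^ 2 := by
  have h1 := le_of_gradient_lipschitz hd hL x (-((η / ‖m‖) • m))
  rw [← sub_eq_add_neg, inner_neg_right, inner_smul_right, norm_neg, norm_smul] at h1
  have hg : ‖gradient f x‖ ≤ ‖m‖ + ‖m - gradient f x‖ := by
    have := norm_sub_le m (m - gradient f x)
    rwa [sub_sub_cancel] at this
  rcases eq_or_ne m 0 with rfl | hm
  · simp only [norm_zero, div_zero, zero_mul, smul_zero, sub_zero, zero_sub, norm_neg] at h1 ⊢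
    nlinarith [norm_nonneg (gradient f x), mul_nonneg hη (norm_nonneg (gradient f x)),
      mul_nonneg hL0 (sq_nonneg η)]
  · have hm0 : 0 < ‖m‖ := norm_pos_iff.2 hm
    rw [Real.norm_of_nonneg (by positivity), div_mul_cancel₀ _ hm0.ne'] at h1
    have h2 : ‖m‖ ^ 2 - ‖m - gradient f x‖ * ‖m‖ ≤ inner ℝ (gradient f x) m := by
      have := real_inner_le_norm (m - gradient f x) m
      rw [inner_sub_left, real_inner_self_eq_norm_sq] at this
      linarith
    have h3 : η * (‖m‖ - ‖m - gradient f x‖) ≤ η / ‖m‖ * inner ℝ (gradient f x) m := by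
      calc η * (‖m‖ - ‖m - gradient f x‖)
          = η / ‖m‖ * (‖m‖ ^ 2 - ‖m - gradient f x‖ * ‖m‖) := by
            field_simp
        _ ≤ _ := mul_le_mul_of_nonneg_left h2 (by positivity)
    nlinarith [mul_le_mul_of_nonneg_left hg hη]

/-- One-sided Taylor estimate of order `q` when the `q`-th derivative is only Lipschitz at `0`. -/
lemma abs_sub_taylor_le {h : ℝ → ℝ} {q : ℕ} (hq : 1 ≤ q) (hh : ContDiff ℝ q h) {C : ℝ}
    (hC : ∀ s, 0 ≤ s → |iteratedDeriv q h s - iteratedDeriv q h 0| ≤ C * s) {s : ℝ} (hs : 0 < s) :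
    |h s - ∑ r ∈ Finset.range (q + 1), iteratedDeriv r h 0 / (r.factorial : ℝ) * s ^ r|
      ≤ C * s ^ (q + 1) / (q.factorial : ℝ) := by
  obtain ⟨n, rfl⟩ : ∃ n, q = n + 1 := ⟨q - 1, by omega⟩
  have hu : UniqueDiffOn ℝ (Set.uIcc 0 s) := by
    rw [Set.uIcc_of_le hs.le]
    exact uniqueDiffOn_Icc hs
  have hw : ∀ r ≤ n + 1, ∀ y ∈ Set.uIcc 0 s,
      iteratedDerivWithin r h (Set.uIcc 0 s) y = iteratedDeriv r h y := fun r hr y hy =>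
    iteratedDerivWithin_eq_iteratedDeriv hu (hh.of_le (by exact_mod_cast hr)).contDiffAt hy
  -- The Lagrange remainder of order `q` is compared with the term of degree `q` at `0`. This needs
  -- no derivative of order `q + 1`, and gives `q!` in place of the optimal `(q + 1)!`.
  obtain ⟨y, hy, hty⟩ := taylor_mean_remainder_lagrange (n := n) hs.ne
    (hh.of_le (by exact_mod_cast n.le_succ)).contDiffOn
    (((hh.differentiable_iteratedDeriv n (by exact_mod_cast n.lt_succ_self)).differentiableOn).congr
      fun y hy => hw n n.le_succ y (Set.uIoo_subset_uIcc_self hy))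
  rw [hw _ le_rfl y (Set.uIoo_subset_uIcc_self hy), taylor_within_apply,
    Finset.sum_congr rfl fun r hr => by
      rw [hw r (Finset.mem_range.1 hr).le 0 Set.left_mem_uIcc], sub_zero] at hty
  rw [Finset.sum_range_succ, ← sub_sub]
  have hsum : ∑ r ∈ Finset.range (n + 1), iteratedDeriv r h 0 / (r.factorial : ℝ) * s ^ r
      = ∑ r ∈ Finset.range (n + 1), ((r.factorial : ℝ)⁻¹ * s ^ r) • iteratedDeriv r h 0 :=
    Finset.sum_congr rfl fun r _ => by rw [smul_eq_mul]; ring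
  rw [hsum, hty]
  have hy' : y ∈ Set.Ioo 0 s := by rwa [Set.uIoo_of_le hs.le] at hy
  have e : iteratedDeriv (n + 1) h y * s ^ (n + 1) / ((n + 1).factorial : ℝ)
      - iteratedDeriv (n + 1) h 0 / ((n + 1).factorial : ℝ) * s ^ (n + 1)
      = (iteratedDeriv (n + 1) h y - iteratedDeriv (n + 1) h 0)
        * (s ^ (n + 1) / ((n + 1).factorial : ℝ)) := by ring
  have hf : 0 ≤ s ^ (n + 1) / ((n + 1).factorial : ℝ) := by positivity
  rw [e, abs_mul, abs_of_nonneg hf]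
  have hC0 : 0 ≤ C := by
    have := (abs_nonneg _).trans (hC s hs.le)
    exact nonneg_of_mul_nonneg_left this hs
  calc |iteratedDeriv (n + 1) h y - iteratedDeriv (n + 1) h 0|
        * (s ^ (n + 1) / ((n + 1).factorial : ℝ))
      ≤ C * s * (s ^ (n + 1) / ((n + 1).factorial : ℝ)) :=
        mul_le_mul_of_nonneg_right ((hC y hy'.1.le).trans
          (mul_le_mul_of_nonneg_left hy'.2.le hC0)) hf
    _ = _ := by ring

lemma iteratedDeriv_comp_line {E F : Type*} [NormedAddCommGroup E] [NormedSpace ℝ E]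
    [NormedAddCommGroup F] [NormedSpace ℝ F] {g : E → F} {q : ℕ} (hg : ContDiff ℝ q g)
    (x v : E) {r : ℕ} (hr : r ≤ q) (s : ℝ) :
    iteratedDeriv r (fun s : ℝ => g (x + s • v)) s
      = iteratedFDeriv ℝ r g (x + s • v) (fun _ => v) := by
  have h1 : ContDiff ℝ q (fun y => g (x + y)) := hg.comp (contDiff_const.add contDiff_id)
  have h2 := (ContinuousLinearMap.toSpanSingleton ℝ v).iteratedFDeriv_comp_right h1 s
    (i := r) (by exact_mod_cast hr)
  rw [iteratedFDeriv_comp_add_left] at h2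
  rw [iteratedDeriv_eq_iteratedFDeriv]
  have h3 := congrArg (fun T => T (fun _ => (1 : ℝ))) h2
  simpa [Function.comp_def] using h3

/-- Directional Taylor estimate for the gradient of a function whose derivative of order `q + 1` is
Lipschitz. The coefficients do not depend on `s`. -/
lemma exists_taylor_inner_gradient {f : E → ℝ} {q : ℕ} (hq : 1 ≤ q) (hf : ContDiff ℝ (q + 1 : ℕ) f)
    {L : ℝ} (hL : ∀ x y, ‖iteratedFDeriv ℝ (q + 1) f x - iteratedFDeriv ℝ (q + 1) f y‖
      ≤ L * ‖x - y‖) (x v u : E) :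
    ∃ a : ℕ → ℝ, a 0 = inner ℝ (gradient f x) u ∧ ∀ s : ℝ, 0 < s →
      |inner ℝ (gradient f (x + s • v)) u - ∑ r ∈ Finset.range (q + 1), a r * s ^ r|
        ≤ L * ‖v‖ ^ (q + 1) * ‖u‖ / (q.factorial : ℝ) * s ^ (q + 1) := by
  have hg : ContDiff ℝ q (fderiv ℝ f) := hf.fderiv_right (by norm_cast)
  have hgu : ContDiff ℝ q (fun y => fderiv ℝ f y u) := hg.clm_apply contDiff_const
  set h : ℝ → ℝ := fun s => fderiv ℝ f (x + s • v) u with hdef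
  have hh : ContDiff ℝ q h := hgu.comp (contDiff_const.add (contDiff_id.smul contDiff_const))
  have hit : ∀ s, iteratedDeriv q h s
      = iteratedFDeriv ℝ q (fderiv ℝ f) (x + s • v) (fun _ => v) u := fun s => by
    rw [hdef, iteratedDeriv_comp_line hgu x v le_rfl]
    have := (ContinuousLinearMap.apply ℝ ℝ u).iteratedFDeriv_comp_left
      (hg.contDiffAt (x := x + s • v)) (i := q) le_rfl
    have h3 := congrArg (fun T => T (fun _ => v)) this
    simpa [Function.comp_def] using h3
  have hC : ∀ s, 0 ≤ s → |iteratedDeriv q h s - iteratedDeriv q h 0|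
      ≤ L * ‖v‖ ^ (q + 1) * ‖u‖ * s := fun s hs => by
    have hnorm : ‖iteratedFDeriv ℝ q (fderiv ℝ f) (x + s • v)
        - iteratedFDeriv ℝ q (fderiv ℝ f) (x + (0 : ℝ) • v)‖ ≤ L * (s * ‖v‖) := by
      have := hL (x + s • v) (x + (0 : ℝ) • v)
      rw [iteratedFDeriv_succ_eq_comp_right, iteratedFDeriv_succ_eq_comp_right,
        Function.comp_apply, Function.comp_apply, ← dist_eq_norm, LinearIsometryEquiv.dist_map,
        dist_eq_norm, add_sub_add_left_eq_sub, ← sub_smul, sub_zero, norm_smul,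
        Real.norm_of_nonneg hs] at this
      exact this
    rw [hit, hit]
    have e : iteratedFDeriv ℝ q (fderiv ℝ f) (x + s • v) (fun _ => v) u
        - iteratedFDeriv ℝ q (fderiv ℝ f) (x + (0 : ℝ) • v) (fun _ => v) u
        = (iteratedFDeriv ℝ q (fderiv ℝ f) (x + s • v)
        - iteratedFDeriv ℝ q (fderiv ℝ f) (x + (0 : ℝ) • v)) (fun _ => v) u := rfl
    rw [e, ← Real.norm_eq_abs]
    refine (ContinuousLinearMap.le_opNorm _ u).trans ?_
    have h1 := ContinuousMultilinearMap.le_opNorm (iteratedFDeriv ℝ q (fderiv ℝ f) (x + s • v)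
        - iteratedFDeriv ℝ q (fderiv ℝ f) (x + (0 : ℝ) • v)) (fun _ => v)
    rw [Finset.prod_const, Finset.card_univ, Fintype.card_fin] at h1
    calc _ ≤ (L * (s * ‖v‖) * ‖v‖ ^ q) * ‖u‖ := by
          refine mul_le_mul_of_nonneg_right (h1.trans ?_) (norm_nonneg u)
          exact mul_le_mul_of_nonneg_right hnorm (by positivity)
      _ = _ := by ring
  refine ⟨fun r => iteratedDeriv r h 0 / (r.factorial : ℝ), ?_, fun s hs => ?_⟩
  · simp [hdef, inner_gradient_left]
  · have := abs_sub_taylor_le hq hh hC hs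
    rw [inner_gradient_left]
    calc _ ≤ _ := this
      _ = _ := by ring

/-- Bias of the extrapolated momentum. Combining the gradients at the points `x + τ_t v` with
weights that solve the Vandermonde system cancels all Taylor terms of degree at most `q`, and only
the remainders are left. -/
lemma norm_extrapolation_bias_le {f : E → ℝ} {q : ℕ} (hq : 1 ≤ q)
    (hf : ContDiff ℝ (q + 1 : ℕ) f) {L : ℝ}
    (hL : ∀ x y, ‖iteratedFDeriv ℝ (q + 1) f x - iteratedFDeriv ℝ (q + 1) f y‖ ≤ L * ‖x - y‖)
    {S : Finset ℕ} {θ τ : ℕ → ℝ} (hτ : ∀ t ∈ S, 0 < τ t)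
    (hV : ∀ r ∈ Finset.Icc 1 q, ∑ t ∈ S, θ t * τ t ^ r = 1) (x v : E) :
    ‖(1 - ∑ t ∈ S, θ t) • gradient f x + ∑ t ∈ S, θ t • gradient f (x + τ t • v)
        - gradient f (x + v)‖
      ≤ L * ‖v‖ ^ (q + 1) / (q.factorial : ℝ) * (1 + ∑ t ∈ S, |θ t| * τ t ^ (q + 1)) := by
  set b := (1 - ∑ t ∈ S, θ t) • gradient f x + ∑ t ∈ S, θ t • gradient f (x + τ t • v)
        - gradient f (x + v) with hb
  obtain ⟨a, ha0, ha⟩ := exists_taylor_inner_gradient hq hf hL x v b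
  set C := L * ‖v‖ ^ (q + 1) * ‖b‖ / (q.factorial : ℝ)
  set T : ℝ → ℝ := fun s => ∑ r ∈ Finset.range (q + 1), a r * s ^ r with hT
  have hcancel : (1 - ∑ t ∈ S, θ t) * a 0 + ∑ t ∈ S, θ t * T (τ t) - T 1 = 0 := by
    have h1 : ∑ t ∈ S, θ t * T (τ t)
        = ∑ r ∈ Finset.range (q + 1), a r * ∑ t ∈ S, θ t * τ t ^ r := by
      simp only [hT, Finset.mul_sum]
      rw [Finset.sum_comm]
      exact Finset.sum_congr rfl fun r _ => Finset.sum_congr rfl fun t _ => by ring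
    rw [h1, hT]
    simp only [one_pow, mul_one]
    have h2 : ∑ r ∈ Finset.Icc 1 q, a r * ∑ t ∈ S, θ t * τ t ^ r = ∑ r ∈ Finset.Icc 1 q, a r :=
      Finset.sum_congr rfl fun r hr => by rw [hV r hr, mul_one]
    rw [range_succ_eq_insert_Icc, Finset.sum_insert (by simp), Finset.sum_insert (by simp), h2]
    simp only [pow_zero, mul_one]
    ring
  have hsq : ‖b‖ ^ 2 = ∑ t ∈ S, θ t * (inner ℝ (gradient f (x + τ t • v)) b - T (τ t))
      - (inner ℝ (gradient f (x + v)) b - T 1) := by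
    rw [← real_inner_self_eq_norm_sq]
    conv_lhs => rw [hb]
    rw [← hb, inner_sub_left, inner_add_left, real_inner_smul_left, sum_inner, ← ha0]
    simp only [real_inner_smul_left, mul_sub, Finset.sum_sub_distrib]
    linarith
  have h1 : ‖b‖ ^ 2 ≤ C * (1 + ∑ t ∈ S, |θ t| * τ t ^ (q + 1)) := by
    rw [hsq]
    have h2 := ha 1 one_pos
    rw [one_smul, one_pow, mul_one] at h2
    have h3 : ∑ t ∈ S, θ t * (inner ℝ (gradient f (x + τ t • v)) b - T (τ t))
        ≤ ∑ t ∈ S, C * (|θ t| * τ t ^ (q + 1)) := Finset.sum_le_sum fun t ht => by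
      refine (le_abs_self _).trans ?_
      rw [abs_mul]
      calc |θ t| * |inner ℝ (gradient f (x + τ t • v)) b - T (τ t)|
          ≤ |θ t| * (C * τ t ^ (q + 1)) :=
            mul_le_mul_of_nonneg_left (ha (τ t) (hτ t ht)) (abs_nonneg _)
        _ = _ := by ring
    rw [← Finset.mul_sum] at h3
    have h4 := (abs_le.1 h2).1
    simp only [hT] at h3 ⊢
    simp only [C] at h3 h4 ⊢
    simp only [one_pow] at h4 ⊢
    linarith
  rcases (norm_nonneg b).eq_or_lt with h0 | h0
  · rw [← h0]
    have hL0 : 0 ≤ L * ‖v‖ := by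
      have := (norm_nonneg _).trans (hL (x + v) x)
      rwa [add_sub_cancel_left] at this
    have h5 : 0 ≤ ∑ t ∈ S, |θ t| * τ t ^ (q + 1) := Finset.sum_nonneg fun t ht =>
      mul_nonneg (abs_nonneg _) (pow_nonneg (hτ t ht).le _)
    rw [pow_succ', ← mul_assoc]
    positivity
  · refine le_of_mul_le_mul_right ?_ h0
    rw [← sq]
    refine h1.trans (le_of_eq ?_)
    simp only [C]
    ring

end Smooth

/-! ### Inequalities for `α`-th powers, `1 < α ≤ 2` -/

section Powers

/-- First-order expansion of `‖·‖ ^ α` with a remainder of order `α`. For `‖b‖ ≤ ‖a‖` it follows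
from the concavity of `s ↦ s ^ (α / 2)` at `‖a‖ ^ 2`; otherwise every term is at most a multiple of
`‖b‖ ^ α`. -/
lemma norm_add_rpow_le {E : Type*} [NormedAddCommGroup E] [InnerProductSpace ℝ E] {α : ℝ}
    (h1 : 1 < α) (h2 : α ≤ 2) (a b : E) :
    ‖a + b‖ ^ α ≤ ‖a‖ ^ α + α * ‖a‖ ^ (α - 2) * inner ℝ a b + 6 * ‖b‖ ^ α := by
  have hb0 : 0 ≤ ‖b‖ ^ α := by positivity
  rcases eq_or_ne a 0 with rfl | ha
  · simp only [zero_add, inner_zero_left, mul_zero, norm_zero, add_zero]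
    rw [Real.zero_rpow (by linarith)]
    linarith
  have ha0 : 0 < ‖a‖ := norm_pos_iff.2 ha
  rcases le_or_gt ‖b‖ ‖a‖ with hab | hab
  · set s := (2 * inner ℝ a b + ‖b‖ ^ 2) / ‖a‖ ^ 2 with hs
    have hsq : ‖a + b‖ ^ 2 = ‖a‖ ^ 2 * (1 + s) := by
      rw [norm_add_sq_real, hs]
      field_simp
      ring
    have hs1 : 0 ≤ 1 + s := by
      have : 0 ≤ ‖a‖ ^ 2 * (1 + s) := hsq ▸ sq_nonneg _
      exact nonneg_of_mul_nonneg_right this (by positivity)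
    have e : ∀ x : ℝ, 0 ≤ x → (x ^ 2) ^ (α / 2) = x ^ α := fun x hx => by
      rw [← Real.rpow_natCast_mul hx]
      congr 1
      push_cast
      ring
    rw [← e _ (norm_nonneg (a + b)), hsq, Real.mul_rpow (by positivity) hs1, e _ ha0.le]
    have hB := rpow_one_add_le_one_add_mul_self (s := s) (by linarith) (p := α / 2)
      (by linarith) (by linarith)
    have hexp : ‖a‖ ^ α = ‖a‖ ^ (α - 2) * ‖a‖ ^ 2 := by
      rw [← Real.rpow_natCast, ← Real.rpow_add ha0]
      congr 1
      push_cast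
      ring
    have hb2 : ‖a‖ ^ (α - 2) * ‖b‖ ^ 2 ≤ ‖b‖ ^ α := by
      have e2 : ‖b‖ ^ 2 = ‖b‖ ^ (2 - α) * ‖b‖ ^ α := by
        rw [← Real.rpow_add_of_nonneg (norm_nonneg b) (by linarith) (by linarith),
          ← Real.rpow_natCast]
        congr 1
        push_cast
        ring
      have e3 : ‖a‖ ^ (α - 2) * ‖a‖ ^ (2 - α) = 1 := by
        rw [← Real.rpow_add ha0]
        simp
      calc ‖a‖ ^ (α - 2) * ‖b‖ ^ 2 = ‖a‖ ^ (α - 2) * ‖b‖ ^ (2 - α) * ‖b‖ ^ α := by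
            rw [e2]
            ring
        _ ≤ ‖a‖ ^ (α - 2) * ‖a‖ ^ (2 - α) * ‖b‖ ^ α := by
            have : ‖b‖ ^ (2 - α) ≤ ‖a‖ ^ (2 - α) :=
              Real.rpow_le_rpow (norm_nonneg b) hab (by linarith)
            gcongr
        _ = ‖b‖ ^ α := by rw [e3, one_mul]
    have h3 : ‖a‖ ^ α * s = ‖a‖ ^ (α - 2) * (2 * inner ℝ a b + ‖b‖ ^ 2) := by
      rw [hexp, hs]
      field_simp
    have h4 := mul_le_mul_of_nonneg_left hB (by positivity : 0 ≤ ‖a‖ ^ α)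
    have h5 : ‖a‖ ^ α * (1 + α / 2 * s) = ‖a‖ ^ α + α * ‖a‖ ^ (α - 2) * inner ℝ a b
        + α / 2 * (‖a‖ ^ (α - 2) * ‖b‖ ^ 2) := by
      linear_combination (α / 2) * h3
    have h6 : α / 2 * (‖a‖ ^ (α - 2) * ‖b‖ ^ 2) ≤ 1 * ‖b‖ ^ α :=
      mul_le_mul (by linarith) hb2 (by positivity) zero_le_one
    linarith
  · have h3 : ‖a + b‖ ^ α ≤ 4 * ‖b‖ ^ α := by
      calc ‖a + b‖ ^ α ≤ (2 * ‖b‖) ^ α :=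
            Real.rpow_le_rpow (norm_nonneg _) (by linarith [norm_add_le a b]) (by linarith)
        _ = 2 ^ α * ‖b‖ ^ α := Real.mul_rpow (by norm_num) (norm_nonneg b)
        _ ≤ 4 * ‖b‖ ^ α := by
            refine mul_le_mul_of_nonneg_right ?_ hb0
            calc (2 : ℝ) ^ α ≤ 2 ^ (2 : ℝ) := Real.rpow_le_rpow_of_exponent_le (by norm_num) h2
              _ = 4 := by norm_num
    have h4 : -(2 * ‖b‖ ^ α) ≤ α * ‖a‖ ^ (α - 2) * inner ℝ a b := by
      have h5 : -(‖a‖ * ‖b‖) ≤ inner ℝ a b := (abs_le.1 (abs_real_inner_le_norm a b)).1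
      have h6 : ‖a‖ ^ (α - 2) * (‖a‖ * ‖b‖) ≤ ‖b‖ ^ α := by
        have e1 : ‖a‖ ^ (α - 2) * ‖a‖ = ‖a‖ ^ (α - 1) := by
          rw [← Real.rpow_add_one ha0.ne']
          congr 1
          ring
        have e2 : ‖b‖ ^ α = ‖b‖ ^ (α - 1) * ‖b‖ := by
          rw [← Real.rpow_add_one (ha0.trans hab).ne']
          congr 1
          ring
        rw [← mul_assoc, e1, e2]
        exact mul_le_mul_of_nonneg_right (Real.rpow_le_rpow ha0.le hab.le (by linarith))
          (norm_nonneg b)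
      have h7 : 0 ≤ ‖a‖ ^ (α - 2) * (‖a‖ * ‖b‖) := by positivity
      have h8 := mul_le_mul_of_nonneg_left h5 (by positivity : 0 ≤ α * ‖a‖ ^ (α - 2))
      nlinarith
    have : 0 ≤ ‖a‖ ^ α := by positivity
    linarith

/-- Convexity of `‖·‖ ^ α` applied to `(1 - θ) a + θ (b / θ)`. -/
lemma norm_contraction_add_rpow_le {E : Type*} [NormedAddCommGroup E] [NormedSpace ℝ E] {α : ℝ}
    (h1 : 1 < α) {θ : ℝ} (h0 : 0 < θ) (hθ : θ < 1) (a b : E) :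
    ‖(1 - θ) • a + b‖ ^ α ≤ (1 - θ) * ‖a‖ ^ α + θ ^ (1 - α) * ‖b‖ ^ α := by
  have hn : ‖(1 - θ) • a + b‖ ≤ (1 - θ) • ‖a‖ + θ • (‖b‖ / θ) := by
    refine (norm_add_le _ _).trans (le_of_eq ?_)
    rw [norm_smul, Real.norm_of_nonneg (by linarith), smul_eq_mul, smul_eq_mul,
      mul_div_cancel₀ _ h0.ne']
  have hc := (convexOn_rpow h1.le).2 (Set.mem_Ici.2 (norm_nonneg a))
    (Set.mem_Ici.2 (by positivity : 0 ≤ ‖b‖ / θ)) (by linarith : 0 ≤ 1 - θ) h0.le (by ring)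
  refine ((Real.rpow_le_rpow (norm_nonneg _) hn (by linarith)).trans hc).trans (le_of_eq ?_)
  simp only [smul_eq_mul]
  rw [Real.div_rpow (norm_nonneg b) h0.le, Real.rpow_sub h0,
    Real.rpow_one]
  ring

/-- Young's inequality with the exponents `α` and `α / (α - 1)`, with its sharp constant. -/
lemma two_mul_mul_le_young {α : ℝ} (h1 : 1 < α) {η c e : ℝ} (hη : 0 ≤ η) (hc : 0 < c)
    (he : 0 ≤ e) :
    2 * η * e ≤ c * e ^ α
      + (α - 1) * (2 / α) ^ (α / (α - 1)) * (η ^ α / c) ^ (1 / (α - 1)) := by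
  have hα : 0 < α := by linarith
  have hα1 : 0 < α - 1 := by linarith
  have hpq : α.HolderConjugate (α / (α - 1)) := Real.HolderConjugate.conjExponent h1
  have hca : 0 < c * α := by positivity
  set u := (c * α) ^ (1 / α) with hu
  have hu0 : 0 < u := Real.rpow_pos_of_pos hca _
  have hY := Real.young_inequality_of_nonneg (a := u * e) (b := 2 * η / u) (by positivity)
    (by positivity) hpq
  have e1 : u * e * (2 * η / u) = 2 * η * e := by field_simp
  have e2 : (u * e) ^ α / α = c * e ^ α := by
    rw [Real.mul_rpow hu0.le he, hu, ← Real.rpow_mul hca.le, one_div_mul_cancel hα.ne',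
      Real.rpow_one]
    field_simp
  have e3 : (2 * η / u) ^ (α / (α - 1)) / (α / (α - 1))
      = (α - 1) * (2 / α) ^ (α / (α - 1)) * (η ^ α / c) ^ (1 / (α - 1)) := by
    have hs : α / (α - 1) = 1 / (α - 1) + 1 := by field_simp; ring
    have f1 : u ^ (α / (α - 1)) = c ^ (1 / (α - 1)) * α ^ (1 / (α - 1)) := by
      rw [hu, ← Real.rpow_mul hca.le, ← Real.mul_rpow hc.le hα.le]
      congr 1
      field_simp
    have f2 : (η ^ α) ^ (1 / (α - 1)) = η ^ (α / (α - 1)) := by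
      rw [← Real.rpow_mul hη]
      congr 1
      field_simp
    have f3 : α ^ (α / (α - 1)) = α ^ (1 / (α - 1)) * α := by
      rw [hs, Real.rpow_add_one hα.ne']
    rw [Real.div_rpow (by positivity) hu0.le, Real.mul_rpow zero_le_two hη, f1,
      Real.div_rpow zero_le_two hα.le, Real.div_rpow (by positivity) hc.le, f2, f3]
    have : 0 < c ^ (1 / (α - 1)) := by positivity
    have : 0 < α ^ (1 / (α - 1)) := by positivity
    field_simp
  rw [e1, e2, e3] at hY
  exact hY

end Powers

/-! ### The parameter schedule -/

section Schedule

variable {p : ℕ} {α : ℝ}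

lemma memDen_pos (hp : 2 ≤ p) (h1 : 1 < α) : 0 < memDen p α := by
  have : (2 : ℝ) ≤ p := by exact_mod_cast hp
  unfold memDen
  nlinarith

/-- The weights `(k + 4) ^ (p α² / d - 1)` of the momentum errors in the potential. The exponent is
the one for which the weighted noise `γ_k ^ α` is exactly `1 / (k + 4)`; it may be negative. -/
noncomputable def potWeight (p : ℕ) (α : ℝ) (k : ℕ) : ℝ :=
  ((k : ℝ) + 4) ^ (p * α ^ 2 / memDen p α - 1)

lemma potWeight_pos (k : ℕ) : 0 < potWeight p α k := Real.rpow_pos_of_pos (by positivity) _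

lemma memEta_pos (k : ℕ) : 0 < memEta p α k :=
  one_div_pos.2 (Real.rpow_pos_of_pos (by positivity) _)

lemma memBaseGamma_pos (k : ℕ) : 0 < memBaseGamma p α k :=
  one_div_pos.2 (Real.rpow_pos_of_pos (by positivity) _)

lemma memEta_eq (k : ℕ) :
    memEta p α k = ((k : ℝ) + 4) ^ (-((p * α + α - 1) / memDen p α)) := by
  rw [memEta, Real.rpow_neg (by positivity), one_div]

lemma memBaseGamma_eq (k : ℕ) :
    memBaseGamma p α k = ((k : ℝ) + 4) ^ (-(p * α / memDen p α)) := by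
  rw [memBaseGamma, Real.rpow_neg (by positivity), one_div]

lemma memBaseGamma_lt_one (hp : 2 ≤ p) (h1 : 1 < α) (k : ℕ) : memBaseGamma p α k < 1 := by
  have hd := memDen_pos hp h1
  have hp0 : (0 : ℝ) < p := by positivity
  rw [memBaseGamma_eq]
  refine Real.rpow_lt_one_of_one_lt_of_neg ?_ (neg_neg_of_pos (by positivity))
  linarith [Nat.cast_nonneg (α := ℝ) k]

lemma inv_le_memBaseGamma (hp : 2 ≤ p) (h1 : 1 < α) (k : ℕ) :
    1 / ((k : ℝ) + 4) ≤ memBaseGamma p α k := by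
  have hd := memDen_pos hp h1
  have hp0 : (0 : ℝ) < p := by positivity
  have hk : (1 : ℝ) ≤ (k : ℝ) + 4 := by linarith [Nat.cast_nonneg (α := ℝ) k]
  rw [memBaseGamma_eq, one_div, ← Real.rpow_neg_one]
  refine Real.rpow_le_rpow_of_exponent_le hk (neg_le_neg ((div_le_one hd).2 ?_))
  unfold memDen
  nlinarith

lemma memEta_sq_le (hp : 2 ≤ p) (h1 : 1 < α) (k : ℕ) :
    memEta p α k ^ 2 ≤ 1 / ((k : ℝ) + 4) := by
  have hd := memDen_pos hp h1
  have hp0 : (0 : ℝ) < p := by positivity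
  have hk : (1 : ℝ) ≤ (k : ℝ) + 4 := by linarith [Nat.cast_nonneg (α := ℝ) k]
  rw [memEta_eq, ← Real.rpow_mul_natCast (by positivity), one_div, ← Real.rpow_neg_one]
  refine Real.rpow_le_rpow_of_exponent_le hk ?_
  have : 1 ≤ (p * α + α - 1) / memDen p α * 2 := by
    rw [div_mul_eq_mul_div, le_div_iff₀ hd]
    unfold memDen
    nlinarith
  push_cast
  linarith

lemma potExponent_le (hp : 2 ≤ p) (h1 : 1 < α) (h2 : α ≤ 2) :
    p * α ^ 2 / memDen p α - 1 ≤ 1 / 3 := by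
  have hd := memDen_pos hp h1
  have hp0 : (0 : ℝ) < p := by positivity
  have : p * α ^ 2 / memDen p α ≤ 4 / 3 := by
    rw [div_le_iff₀ hd]
    unfold memDen
    nlinarith [mul_nonneg hp0.le (mul_nonneg (by linarith : 0 ≤ 3 * α - 2) (sub_nonneg.2 h2))]
  linarith

lemma potWeight_zero_le (hp : 2 ≤ p) (h1 : 1 < α) (h2 : α ≤ 2) :
    potWeight p α 0 ≤ (4 : ℝ) ^ (1 / 3 : ℝ) := by
  rw [potWeight, Nat.cast_zero, zero_add]
  exact Real.rpow_le_rpow_of_exponent_le (by norm_num) (potExponent_le hp h1 h2)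

lemma potWeight_succ_le (hp : 2 ≤ p) (h1 : 1 < α) (h2 : α ≤ 2) (k : ℕ) :
    potWeight p α (k + 1) ≤ potWeight p α k * (1 + memBaseGamma p α k / 3) := by
  set y : ℝ := (k : ℝ) + 4 with hy
  have hy0 : 0 < y := by positivity
  have e : ((k + 1 : ℕ) : ℝ) + 4 = y * (1 + 1 / y) := by
    rw [mul_add, mul_one_div_cancel hy0.ne', hy]
    push_cast
    ring
  have hb : 0 ≤ 1 / y := by positivity
  rw [potWeight, e, Real.mul_rpow hy0.le (by positivity), potWeight, ← hy]
  refine mul_le_mul_of_nonneg_left ?_ (by positivity)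
  calc (1 + 1 / y) ^ (p * α ^ 2 / memDen p α - 1) ≤ (1 + 1 / y) ^ (1 / 3 : ℝ) :=
        Real.rpow_le_rpow_of_exponent_le (by linarith) (potExponent_le hp h1 h2)
    _ ≤ 1 + 1 / 3 * (1 / y) :=
        rpow_one_add_le_one_add_mul_self (by linarith) (by norm_num) (by norm_num)
    _ ≤ 1 + memBaseGamma p α k / 3 := by
        have := inv_le_memBaseGamma hp h1 k
        linarith

lemma potWeight_succ_le_two_mul (hp : 2 ≤ p) (h1 : 1 < α) (h2 : α ≤ 2) (k : ℕ) :
    potWeight p α (k + 1) ≤ 2 * potWeight p α k := by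
  refine (potWeight_succ_le hp h1 h2 k).trans ?_
  have := memBaseGamma_lt_one hp h1 k
  nlinarith [potWeight_pos (p := p) (α := α) k]

/-- The ratio whose `1 / (α - 1)`-th power Young's inequality produces. -/
lemma memEta_rpow_div (hp : 2 ≤ p) (h1 : 1 < α) (k : ℕ) :
    memEta p α k ^ α / (memBaseGamma p α k * potWeight p α k) = ((k : ℝ) + 4) ^ (-(α - 1)) := by
  have hd := memDen_pos hp h1
  have hk : (0 : ℝ) < (k : ℝ) + 4 := by positivity
  rw [memEta_eq, memBaseGamma_eq, potWeight, ← Real.rpow_mul hk.le, ← Real.rpow_add hk,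
    ← Real.rpow_sub hk]
  congr 1
  have hd' := hd.ne'
  field_simp
  unfold memDen
  ring

lemma potWeight_mul_memBaseGamma_rpow (k : ℕ) :
    potWeight p α k * memBaseGamma p α k ^ α = 1 / ((k : ℝ) + 4) := by
  have hk : (0 : ℝ) < (k : ℝ) + 4 := by positivity
  rw [memBaseGamma_eq, potWeight, ← Real.rpow_mul hk.le, ← Real.rpow_add hk, one_div,
    ← Real.rpow_neg_one]
  congr 1
  ring

/-- The weighted bias, without its constant. -/
lemma potWeight_mul_bias (hp : 2 ≤ p) (h1 : 1 < α) (k : ℕ) :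
    potWeight p α k * (memBaseGamma p α k ^ (1 - α) *
      (memEta p α k ^ p / memBaseGamma p α k ^ (p - 1)) ^ α) = 1 / ((k : ℝ) + 4) := by
  have hd := (memDen_pos hp h1).ne'
  have hk : (0 : ℝ) < (k : ℝ) + 4 := by positivity
  rw [memEta_eq, memBaseGamma_eq, potWeight, ← Real.rpow_mul_natCast hk.le,
    ← Real.rpow_mul_natCast hk.le, ← Real.rpow_mul hk.le, ← Real.rpow_sub hk,
    ← Real.rpow_mul hk.le, ← Real.rpow_add hk, ← Real.rpow_add hk, one_div, ← Real.rpow_neg_one]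
  congr 1
  rw [Nat.cast_sub (by omega)]
  push_cast
  field_simp
  ring

lemma sum_inv_le_log {K : ℕ} (hK : 5 ≤ K) :
    ∑ k ∈ Finset.range K, 1 / ((k : ℝ) + 4) ≤ Real.log K := by
  have h : ∀ K : ℕ, ∑ k ∈ Finset.range K, 1 / ((k : ℝ) + 4) ≤ Real.log (((K : ℝ) + 3) / 3) := by
    intro K
    induction K with
    | zero => simp
    | succ K ih =>
      rw [Finset.sum_range_succ]
      have h1 := Real.one_sub_inv_le_log_of_pos (x := ((K : ℝ) + 4) / (K + 3)) (by positivity)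
      have e1 : 1 - (((K : ℝ) + 4) / (K + 3))⁻¹ = 1 / ((K : ℝ) + 4) := by field_simp; ring
      have e2 : Real.log (((K + 1 : ℕ) + 3 : ℝ) / 3)
          = Real.log (((K : ℝ) + 3) / 3) + Real.log (((K : ℝ) + 4) / (K + 3)) := by
        rw [← Real.log_mul (by positivity) (by positivity)]
        congr 1
        push_cast
        field_simp
        ring
      rw [e2]
      rw [e1] at h1
      linarith
  refine (h K).trans (Real.log_le_log (by positivity) ?_)
  have : (5 : ℝ) ≤ K := by exact_mod_cast hK
  linarith

end Schedule

/-! ### One step of the momentum recursion in expectation -/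

section OneStep

variable {E : Type*} [NormedAddCommGroup E] [InnerProductSpace ℝ E] [CompleteSpace E]

/-- Adding centred noise to a fixed vector: the linear term of `norm_add_rpow_le` has mean zero. -/
lemma lintegral_norm_add_rpow_le {W : Type*} [MeasurableSpace W] {ν : Measure W}
    [IsProbabilityMeasure ν] {α : ℝ} (h1 : 1 < α) (h2 : α ≤ 2) {N : W → E} (hN : Integrable N ν)
    (hN0 : ∫ w, N w ∂ν = 0) (hNα : Integrable (fun w => ‖N w‖ ^ α) ν) {V : ℝ}
    (hV : ∫ w, ‖N w‖ ^ α ∂ν ≤ V) (a : E) :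
    ∫⁻ w, ENNReal.ofReal (‖a + N w‖ ^ α) ∂ν ≤ ENNReal.ofReal (‖a‖ ^ α + 6 * V) := by
  set g : W → ℝ := fun w => ‖a‖ ^ α + α * ‖a‖ ^ (α - 2) * inner ℝ a (N w) + 6 * ‖N w‖ ^ α
  have i1 : Integrable (fun w => α * ‖a‖ ^ (α - 2) * inner ℝ a (N w)) ν :=
    (hN.const_inner a).const_mul _
  have i2 : Integrable (fun w => ‖a‖ ^ α + α * ‖a‖ ^ (α - 2) * inner ℝ a (N w)) ν :=
    (integrable_const _).add i1
  have hg : Integrable g ν := i2.add (hNα.const_mul 6)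
  have hle : ∀ w, ‖a + N w‖ ^ α ≤ g w := fun w => norm_add_rpow_le h1 h2 a (N w)
  calc ∫⁻ w, ENNReal.ofReal (‖a + N w‖ ^ α) ∂ν
      ≤ ∫⁻ w, ENNReal.ofReal (g w) ∂ν := lintegral_mono fun w => ENNReal.ofReal_le_ofReal (hle w)
    _ = ENNReal.ofReal (∫ w, g w ∂ν) := (ofReal_integral_eq_lintegral_ofReal hg
        (Filter.Eventually.of_forall fun w =>
          (by positivity : (0 : ℝ) ≤ ‖a + N w‖ ^ α).trans (hle w))).symm
    _ ≤ _ := by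
        refine ENNReal.ofReal_le_ofReal ?_
        rw [integral_add i2 (hNα.const_mul 6), integral_add (integrable_const _) i1,
          integral_const_mul, integral_const_mul, integral_inner hN, hN0]
        simp only [integral_const, probReal_univ, one_smul, inner_zero_right, mul_zero, add_zero]
        linarith

/-- If the noise `N y ·` has mean zero and `α`-th moment at most `V` for each fixed state `y`, and
the state `Y` is independent of the fresh sample `Z`, then adding the noise to `A Y` increases the
`α`-th moment by at most `6 V`. Conditioning on the state is Fubini's theorem for the product
law. -/
lemma integrable_and_integral_norm_add_noise_rpow_le [MeasurableSpace E] [BorelSpace E]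
    [SecondCountableTopology E] {Ω S W : Type*} [MeasurableSpace Ω] [MeasurableSpace S]
    [MeasurableSpace W] {P : Measure Ω} [IsProbabilityMeasure P] {α : ℝ} (h1 : 1 < α) (h2 : α ≤ 2)
    {Y : Ω → S} {Z : Ω → W} (hY : Measurable Y) (hZ : Measurable Z) (hYZ : IndepFun Y Z P)
    {A : S → E} {N : S → W → E} (hA : Measurable A) (hN : Measurable (Function.uncurry N)) {V : ℝ}
    (hV0 : 0 ≤ V) (hNi : ∀ y, Integrable (N y) (P.map Z)) (hN0 : ∀ y, ∫ w, N y w ∂(P.map Z) = 0)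
    (hNα : ∀ y, Integrable (fun w => ‖N y w‖ ^ α) (P.map Z))
    (hV : ∀ y, ∫ w, ‖N y w‖ ^ α ∂(P.map Z) ≤ V)
    (hAi : Integrable (fun ω => ‖A (Y ω)‖ ^ α) P) :
    Integrable (fun ω => ‖A (Y ω) + N (Y ω) (Z ω)‖ ^ α) P ∧
      ∫ ω, ‖A (Y ω) + N (Y ω) (Z ω)‖ ^ α ∂P ≤ ∫ ω, ‖A (Y ω)‖ ^ α ∂P + 6 * V := by
  have hPZ : IsProbabilityMeasure (P.map Z) := Measure.isProbabilityMeasure_map hZ.aemeasurable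
  have hPY : IsProbabilityMeasure (P.map Y) := Measure.isProbabilityMeasure_map hY.aemeasurable
  have hm : Measurable fun x : S × W => ‖A x.1 + N x.1 x.2‖ ^ α :=
    (((hA.comp measurable_fst).add hN).norm).pow_const α
  have hm' : Measurable fun x : S × W => ENNReal.ofReal (‖A x.1 + N x.1 x.2‖ ^ α) :=
    ENNReal.measurable_ofReal.comp hm
  have hb : Integrable (fun ω => ‖A (Y ω)‖ ^ α + 6 * V) P := hAi.add (integrable_const _)
  have hkey : ∫⁻ ω, ENNReal.ofReal (‖A (Y ω) + N (Y ω) (Z ω)‖ ^ α) ∂P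
      ≤ ENNReal.ofReal (∫ ω, ‖A (Y ω)‖ ^ α ∂P + 6 * V) := by
    calc ∫⁻ ω, ENNReal.ofReal (‖A (Y ω) + N (Y ω) (Z ω)‖ ^ α) ∂P
        = ∫⁻ x, ENNReal.ofReal (‖A x.1 + N x.1 x.2‖ ^ α) ∂(P.map fun ω => (Y ω, Z ω)) :=
          (lintegral_map hm' (hY.prodMk hZ)).symm
      _ = ∫⁻ y, ∫⁻ w, ENNReal.ofReal (‖A y + N y w‖ ^ α) ∂(P.map Z) ∂(P.map Y) := by
          rw [hYZ.map_prod_eq_prod_map_map hY.aemeasurable hZ.aemeasurable,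
            lintegral_prod _ hm'.aemeasurable]
      _ ≤ ∫⁻ y, ENNReal.ofReal (‖A y‖ ^ α + 6 * V) ∂(P.map Y) :=
          lintegral_mono fun y =>
            lintegral_norm_add_rpow_le h1 h2 (hNi y) (hN0 y) (hNα y) (hV y) (A y)
      _ = ∫⁻ ω, ENNReal.ofReal (‖A (Y ω)‖ ^ α + 6 * V) ∂P :=
          lintegral_map (ENNReal.measurable_ofReal.comp
            (((hA.norm).pow_const α).add_const _)) hY
      _ = ENNReal.ofReal (∫ ω, (‖A (Y ω)‖ ^ α + 6 * V) ∂P) :=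
          (ofReal_integral_eq_lintegral_ofReal hb
            (Filter.Eventually.of_forall fun ω => by positivity)).symm
      _ = _ := by
          rw [integral_add hAi (integrable_const _)]
          simp
  have hms : AEStronglyMeasurable (fun ω => ‖A (Y ω) + N (Y ω) (Z ω)‖ ^ α) P :=
    (hm.comp (hY.prodMk hZ)).aestronglyMeasurable
  have hnn : 0 ≤ᵐ[P] fun ω => ‖A (Y ω) + N (Y ω) (Z ω)‖ ^ α :=
    Filter.Eventually.of_forall fun ω => by positivity
  have h0 : 0 ≤ ∫ ω, ‖A (Y ω)‖ ^ α ∂P + 6 * V :=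
    add_nonneg (integral_nonneg fun ω => by positivity) (by positivity)
  have hint : Integrable (fun ω => ‖A (Y ω) + N (Y ω) (Z ω)‖ ^ α) P :=
    ⟨hms, (hasFiniteIntegral_iff_ofReal hnn).2 (hkey.trans_lt ENNReal.ofReal_lt_top)⟩
  refine ⟨hint, ?_⟩
  rw [← ofReal_integral_eq_lintegral_ofReal hint hnn] at hkey
  exact (ENNReal.ofReal_le_ofReal_iff h0).1 hkey

end OneStep

/-! ### The stochastic gradient noise -/

section Noise

variable {n : ℕ} {Ξ : Type*} [MeasurableSpace Ξ] {f : EuclideanSpace ℝ (Fin n) → ℝ}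
  {G : EuclideanSpace ℝ (Fin n) → Ξ → EuclideanSpace ℝ (Fin n)} {D : Measure Ξ}
  {flow L₁ σ α : ℝ}

lemma BasicAssumption.continuous_gradient (h : BasicAssumption f G D flow L₁ σ α) :
    Continuous (gradient f) :=
  (LipschitzWith.of_dist_le_mul (K := L₁.toNNReal) fun x y => by
    rw [dist_eq_norm, dist_eq_norm, Real.coe_toNNReal _ h.L₁_pos.le]
    exact h.gradient_lipschitz x y).continuous

/-- The combined noise `∑_t θ_t (G(z_t; w_t) - ∇ f(z_t))` of one iteration. -/
noncomputable def memNoise (f : EuclideanSpace ℝ (Fin n) → ℝ)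
    (G : EuclideanSpace ℝ (Fin n) → Ξ → EuclideanSpace ℝ (Fin n)) (S : Finset ℕ) (θ : ℕ → ℝ)
    (z : ℕ → EuclideanSpace ℝ (Fin n)) (w : ℕ → Ξ) : EuclideanSpace ℝ (Fin n) :=
  ∑ t ∈ S, θ t • (G (z t) (w t) - gradient f (z t))

variable {S : Finset ℕ} {θ : ℕ → ℝ} {z : ℕ → EuclideanSpace ℝ (Fin n)} {ν : Measure (ℕ → Ξ)}

lemma integrable_comp_eval {F : Type*} [NormedAddCommGroup F] {g : Ξ → F} (hg : Integrable g D)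
    {t : ℕ} (hν : ν.map (fun w => w t) = D) : Integrable (fun w => g (w t)) ν := by
  rw [← hν] at hg
  exact (integrable_map_measure hg.aestronglyMeasurable
    (measurable_pi_apply t).aemeasurable).1 hg

lemma integral_comp_eval {F : Type*} [NormedAddCommGroup F] [NormedSpace ℝ F] {g : Ξ → F}
    (hg : Integrable g D) {t : ℕ} (hν : ν.map (fun w => w t) = D) :
    ∫ w, g (w t) ∂ν = ∫ x, g x ∂D := by
  rw [← hν] at hg ⊢
  exact (integral_map (measurable_pi_apply t).aemeasurable hg.aestronglyMeasurable).symm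

lemma integrable_memNoise [IsProbabilityMeasure D] (h : BasicAssumption f G D flow L₁ σ α)
    (hν : ∀ t, ν.map (fun w => w t) = D) : Integrable (memNoise f G S θ z) ν := by
  refine integrable_finsetSum S fun t _ => Integrable.fun_smul (θ t) ?_
  exact integrable_comp_eval (g := fun x => G (z t) x - gradient f (z t))
    ((h.integrable_G _).sub (integrable_const _)) (hν t)

lemma integral_memNoise [IsProbabilityMeasure D] (h : BasicAssumption f G D flow L₁ σ α)
    (hν : ∀ t, ν.map (fun w => w t) = D) : ∫ w, memNoise f G S θ z w ∂ν = 0 := by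
  have hi : ∀ t, Integrable (fun x => G (z t) x - gradient f (z t)) D := fun t =>
    (h.integrable_G _).sub (integrable_const _)
  unfold memNoise
  rw [integral_finsetSum S fun t _ => (integrable_comp_eval (hi t) (hν t)).fun_smul (θ t)]
  refine Finset.sum_eq_zero fun t _ => ?_
  rw [integral_smul, integral_comp_eval (hi t) (hν t),
    integral_sub (h.integrable_G _) (integrable_const _), h.unbiased]
  simp

lemma norm_memNoise_rpow_le {Ξ : Type*}
    {G : EuclideanSpace ℝ (Fin n) → Ξ → EuclideanSpace ℝ (Fin n)} (h1 : 1 < α) {C : ℝ}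
    (hC : ∀ t ∈ S, |θ t| ≤ C) (w : ℕ → Ξ) :
    ‖memNoise f G S θ z w‖ ^ α
      ≤ (S.card : ℝ) ^ (α - 1) * C ^ α * ∑ t ∈ S, ‖G (z t) (w t) - gradient f (z t)‖ ^ α := by
  have h0 : ‖memNoise f G S θ z w‖ ≤ ∑ t ∈ S, C * ‖G (z t) (w t) - gradient f (z t)‖ := by
    refine norm_sum_le_of_le S fun t ht => ?_
    rw [norm_smul, Real.norm_eq_abs]
    exact mul_le_mul_of_nonneg_right (hC t ht) (norm_nonneg _)
  have hC0 : ∀ t ∈ S, 0 ≤ C := fun t ht => (abs_nonneg _).trans (hC t ht)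
  refine (Real.rpow_le_rpow (norm_nonneg _) h0 (by linarith)).trans ?_
  refine (Real.rpow_sum_le_const_mul_sum_rpow_of_nonneg S h1.le
    fun t ht => mul_nonneg (hC0 t ht) (norm_nonneg _)).trans (le_of_eq ?_)
  rw [mul_assoc]
  congr 1
  rw [Finset.mul_sum]
  exact Finset.sum_congr rfl fun t ht => Real.mul_rpow (hC0 t ht)
    (norm_nonneg (G (z t) (w t) - gradient f (z t)))

lemma aestronglyMeasurable_memNoise_rpow [IsProbabilityMeasure D]
    (h : BasicAssumption f G D flow L₁ σ α) (hν : ∀ t, ν.map (fun w => w t) = D) :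
    AEStronglyMeasurable (fun w => ‖memNoise f G S θ z w‖ ^ α) ν :=
  ((integrable_memNoise h hν).aestronglyMeasurable.norm.aemeasurable.pow_const
    α).aestronglyMeasurable

lemma integrable_sum_noise_rpow (h : BasicAssumption f G D flow L₁ σ α)
    (hν : ∀ t, ν.map (fun w => w t) = D) :
    Integrable (fun w => ∑ t ∈ S, ‖G (z t) (w t) - gradient f (z t)‖ ^ α) ν :=
  integrable_finsetSum S fun t _ => integrable_comp_eval
    (g := fun x => ‖G (z t) x - gradient f (z t)‖ ^ α) (h.integrable_moment _) (hν t)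

lemma integrable_memNoise_rpow [IsProbabilityMeasure D]
    (h : BasicAssumption f G D flow L₁ σ α) (hν : ∀ t, ν.map (fun w => w t) = D) {C : ℝ}
    (hC : ∀ t ∈ S, |θ t| ≤ C) : Integrable (fun w => ‖memNoise f G S θ z w‖ ^ α) ν := by
  refine ((integrable_sum_noise_rpow (S := S) (z := z) h hν).const_mul
    ((S.card : ℝ) ^ (α - 1) * C ^ α)).mono' (aestronglyMeasurable_memNoise_rpow h hν)
    (Filter.Eventually.of_forall fun w => ?_)
  rw [Real.norm_of_nonneg (by positivity)]
  exact norm_memNoise_rpow_le h.α_gt_one hC w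

/-- No independence of the samples within the iteration is used, only their common law. -/
lemma integral_memNoise_rpow_le [IsProbabilityMeasure D]
    (h : BasicAssumption f G D flow L₁ σ α) (hν : ∀ t, ν.map (fun w => w t) = D) {C : ℝ}
    (hC0 : 0 ≤ C) (hC : ∀ t ∈ S, |θ t| ≤ C) (hS : S.Nonempty) :
    ∫ w, ‖memNoise f G S θ z w‖ ^ α ∂ν ≤ (S.card : ℝ) ^ α * C ^ α * σ ^ α := by
  have hi : ∀ t, Integrable (fun w : ℕ → Ξ => ‖G (z t) (w t) - gradient f (z t)‖ ^ α) ν := fun t =>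
    integrable_comp_eval (g := fun x => ‖G (z t) x - gradient f (z t)‖ ^ α)
      (h.integrable_moment _) (hν t)
  have hc : (0 : ℝ) < S.card := by exact_mod_cast hS.card_pos
  calc ∫ w, ‖memNoise f G S θ z w‖ ^ α ∂ν
      ≤ ∫ w, (S.card : ℝ) ^ (α - 1) * C ^ α
          * ∑ t ∈ S, ‖G (z t) (w t) - gradient f (z t)‖ ^ α ∂ν :=
        integral_mono (integrable_memNoise_rpow h hν hC)
          ((integrable_sum_noise_rpow h hν).const_mul _)
          fun w => norm_memNoise_rpow_le h.α_gt_one hC w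
    _ = (S.card : ℝ) ^ (α - 1) * C ^ α
          * ∑ t ∈ S, ∫ x, ‖G (z t) x - gradient f (z t)‖ ^ α ∂D := by
        rw [integral_const_mul, integral_finsetSum S fun t _ => hi t]
        congr 1
        exact Finset.sum_congr rfl fun t _ => integral_comp_eval
          (g := fun x => ‖G (z t) x - gradient f (z t)‖ ^ α) (h.integrable_moment _) (hν t)
    _ ≤ (S.card : ℝ) ^ (α - 1) * C ^ α * (S.card * σ ^ α) := by
        refine mul_le_mul_of_nonneg_left ?_ (by positivity)
        rw [← nsmul_eq_mul]
        exact Finset.sum_le_card_nsmul S _ _ fun t _ => h.moment_le _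
    _ = _ := by
        rw [Real.rpow_sub_one hc.ne']
        field_simp

end Noise

/-! ### The run of the method as a stochastic process -/

section Trajectory

variable {n : ℕ} {Ξ : Type*} {f : EuclideanSpace ℝ (Fin n) → ℝ}
  {G : EuclideanSpace ℝ (Fin n) → Ξ → EuclideanSpace ℝ (Fin n)}

/-- A state as a point of a product space, which carries the measurable structure. -/
def MemState.toProd {E : Type*} (s : MemState E) : E × E × E := (s.xPrev, s.x, s.mPrev)

/-- The inverse of `MemState.toProd`. -/
def MemState.ofProd {E : Type*} (a : E × E × E) : MemState E := ⟨a.1, a.2.1, a.2.2⟩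

lemma measurable_memZ (γ : ℕ → ℕ → ℝ) (k t : ℕ) :
    Measurable fun a : EuclideanSpace ℝ (Fin n) × EuclideanSpace ℝ (Fin n) ×
      EuclideanSpace ℝ (Fin n) => memZ γ k t (MemState.ofProd a) := by
  unfold memZ MemState.ofProd
  fun_prop

lemma measurable_memDir [MeasurableSpace Ξ] (hG : Measurable (Function.uncurry G)) (q : ℕ)
    (γ θ : ℕ → ℕ → ℝ) (k : ℕ) :
    Measurable fun x : (EuclideanSpace ℝ (Fin n) × EuclideanSpace ℝ (Fin n) ×
      EuclideanSpace ℝ (Fin n)) × (ℕ → Ξ) => memDir G q γ θ k x.2 (MemState.ofProd x.1) := by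
  unfold memDir
  refine Measurable.add ?_ (Finset.measurable_fun_sum _ fun t _ => Measurable.fun_const_smul ?_ _)
  · unfold MemState.ofProd
    fun_prop
  · exact hG.comp (((measurable_memZ γ k t).comp measurable_fst).prodMk
      ((measurable_pi_apply t).comp measurable_snd))

lemma measurable_memStep [MeasurableSpace Ξ] (hG : Measurable (Function.uncurry G)) (q : ℕ)
    (η : ℕ → ℝ) (γ θ : ℕ → ℕ → ℝ) (k : ℕ) :
    Measurable fun x : (EuclideanSpace ℝ (Fin n) × EuclideanSpace ℝ (Fin n) ×
      EuclideanSpace ℝ (Fin n)) × (ℕ → Ξ) =>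
        (memStep G q η γ θ k x.2 (MemState.ofProd x.1)).toProd := by
  have h := measurable_memDir hG q γ θ k
  have hx : Measurable fun x : (EuclideanSpace ℝ (Fin n) × EuclideanSpace ℝ (Fin n) ×
      EuclideanSpace ℝ (Fin n)) × (ℕ → Ξ) => (MemState.ofProd x.1).x := by
    unfold MemState.ofProd
    fun_prop
  exact hx.prodMk ((hx.sub ((measurable_const.div h.norm).smul h)).prodMk h)

/-- The state at the start of iteration `k` depends on the samples of earlier iterations only. -/
lemma measurable_memRun [MeasurableSpace Ξ] {Ω : Type*} (hG : Measurable (Function.uncurry G))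
    (x0 : EuclideanSpace ℝ (Fin n)) (q : ℕ) (η : ℕ → ℝ) (γ θ : ℕ → ℕ → ℝ) (X : ℕ → Ω → ℕ → Ξ)
    (k : ℕ) :
    Measurable[⨆ i ∈ Set.Iio k, MeasurableSpace.comap (X i) inferInstance]
      fun ω => (memRun G x0 q η γ θ (fun i => X i ω) k).toProd := by
  induction k with
  | zero =>
    exact measurable_const (a := ((x0, x0, 0) :
      EuclideanSpace ℝ (Fin n) × EuclideanSpace ℝ (Fin n) × EuclideanSpace ℝ (Fin n)))
  | succ k ih =>
    have h1 : (⨆ i ∈ Set.Iio k, MeasurableSpace.comap (X i) inferInstance)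
        ≤ ⨆ i ∈ Set.Iio (k + 1), MeasurableSpace.comap (X i) inferInstance :=
      biSup_mono fun i hi => (Set.mem_Iio.1 hi).trans k.lt_succ_self
    have h2 : MeasurableSpace.comap (X k) inferInstance
        ≤ ⨆ i ∈ Set.Iio (k + 1), MeasurableSpace.comap (X i) inferInstance :=
      le_biSup (fun i => MeasurableSpace.comap (X i) inferInstance)
        (Set.mem_Iio.2 k.lt_succ_self)
    exact (measurable_memStep hG q η γ θ k).comp
      ((ih.mono h1 le_rfl).prodMk ((comap_measurable (X k)).mono h2 le_rfl))

lemma measurable_memRun_ambient [MeasurableSpace Ξ] {Ω : Type*} [MeasurableSpace Ω]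
    (hG : Measurable (Function.uncurry G)) (x0 : EuclideanSpace ℝ (Fin n)) (q : ℕ) (η : ℕ → ℝ)
    (γ θ : ℕ → ℕ → ℝ) {X : ℕ → Ω → ℕ → Ξ} (hX : ∀ i, Measurable (X i)) (k : ℕ) :
    Measurable fun ω => (memRun G x0 q η γ θ (fun i => X i ω) k).toProd :=
  (measurable_memRun hG x0 q η γ θ X k).mono (iSup₂_le fun i _ => (hX i).comap_le) le_rfl

lemma indepFun_memRun [MeasurableSpace Ξ] {Ω : Type*} [MeasurableSpace Ω] {P : Measure Ω}
    (hG : Measurable (Function.uncurry G)) (x0 : EuclideanSpace ℝ (Fin n)) (q : ℕ) (η : ℕ → ℝ)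
    (γ θ : ℕ → ℕ → ℝ) {X : ℕ → Ω → ℕ → Ξ} (hX : ∀ i, Measurable (X i)) (hind : iIndepFun X P)
    (k : ℕ) :
    IndepFun (fun ω => (memRun G x0 q η γ θ (fun i => X i ω) k).toProd) (X k) P := by
  have h := indep_iSup_of_disjoint (fun i => (hX i).comap_le) hind
    (S := Set.Iio k) (T := {k}) (by simp)
  rw [IndepFun_iff_Indep]
  refine indep_of_indep_of_le_left (indep_of_indep_of_le_right h ?_)
    (measurable_memRun hG x0 q η γ θ X k).comap_le
  exact le_biSup (fun i => MeasurableSpace.comap (X i) inferInstance) (Set.mem_singleton k)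

/-! ### The momentum error -/

/-- The momentum error `m^k - ∇ f(x^k)` without the noise of iteration `k`. -/
noncomputable def memDrift (f : EuclideanSpace ℝ (Fin n) → ℝ) (q : ℕ) (γ θ : ℕ → ℕ → ℝ) (k : ℕ)
    (s : MemState (EuclideanSpace ℝ (Fin n))) : EuclideanSpace ℝ (Fin n) :=
  (1 - ∑ t ∈ Finset.Icc 1 q, memPrevTheta q θ k t) • s.mPrev
    + ∑ t ∈ Finset.Icc 1 q, memPrevTheta q θ k t • gradient f (memZ γ k t s) - gradient f s.x

lemma memDir_sub_gradient (q : ℕ) (γ θ : ℕ → ℕ → ℝ) (k : ℕ) (w : ℕ → Ξ)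
    (s : MemState (EuclideanSpace ℝ (Fin n))) :
    memDir G q γ θ k w s - gradient f s.x = memDrift f q γ θ k s
      + memNoise f G (Finset.Icc 1 q) (memPrevTheta q θ k) (fun t => memZ γ k t s) w := by
  unfold memDir memDrift memNoise
  simp only [smul_sub, Finset.sum_sub_distrib]
  abel

lemma measurable_memDrift (hf : Continuous (gradient f)) (q : ℕ) (γ θ : ℕ → ℕ → ℝ) (k : ℕ) :
    Measurable fun a => memDrift f q γ θ k (MemState.ofProd a) := by
  unfold memDrift
  refine Measurable.sub (Measurable.add ?_ (Finset.measurable_fun_sum _ fun t _ =>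
    Measurable.fun_const_smul (hf.measurable.comp (measurable_memZ γ k t)) _))
    (hf.measurable.comp ?_)
  all_goals
    unfold MemState.ofProd
    fun_prop

lemma measurable_memNoise [MeasurableSpace Ξ] (hG : Measurable (Function.uncurry G))
    (hf : Continuous (gradient f)) (q : ℕ) (γ : ℕ → ℕ → ℝ) (θ : ℕ → ℝ) (k : ℕ) :
    Measurable (Function.uncurry fun a => memNoise f G (Finset.Icc 1 q) θ
      (fun t => memZ γ k t (MemState.ofProd a))) := by
  unfold memNoise Function.uncurry
  refine Finset.measurable_fun_sum _ fun t _ => Measurable.fun_const_smul (Measurable.sub ?_ ?_) _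
  · exact hG.comp (((measurable_memZ γ k t).comp measurable_fst).prodMk
      ((measurable_pi_apply t).comp measurable_snd))
  · exact hf.measurable.comp ((measurable_memZ γ k t).comp measurable_fst)

/-- The run of the method with the parameters of the schedule. -/
noncomputable abbrev memTraj (G : EuclideanSpace ℝ (Fin n) → Ξ → EuclideanSpace ℝ (Fin n))
    (x0 : EuclideanSpace ℝ (Fin n)) (p : ℕ) (α : ℝ) (w : ℕ → ℕ → Ξ) (k : ℕ) :
    MemState (EuclideanSpace ℝ (Fin n)) :=
  memRun G x0 (p - 1) (memEta p α) (memGamma p α) (memTheta p α) w k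

/-- The momentum error `m^k - ∇ f(x^k)`. -/
noncomputable def memErr (f : EuclideanSpace ℝ (Fin n) → ℝ)
    (G : EuclideanSpace ℝ (Fin n) → Ξ → EuclideanSpace ℝ (Fin n))
    (x0 : EuclideanSpace ℝ (Fin n)) (p : ℕ) (α : ℝ) (w : ℕ → ℕ → Ξ) (k : ℕ) :
    EuclideanSpace ℝ (Fin n) :=
  memDir G (p - 1) (memGamma p α) (memTheta p α) k (w k) (memTraj G x0 p α w k)
    - gradient f (memTraj G x0 p α w k).x

variable {x0 : EuclideanSpace ℝ (Fin n)} {p : ℕ} {α : ℝ}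

lemma memTheta_eq (k t : ℕ) :
    memTheta p α k t = extrapWeight (p - 1) (memBaseGamma p α k) t := rfl

lemma inv_memGamma (k t : ℕ) : (memGamma p α k t)⁻¹ = (t : ℝ) ^ 2 / memBaseGamma p α k := by
  rw [memGamma, inv_div]

lemma norm_memTraj_succ_sub_le (w : ℕ → ℕ → Ξ) (k : ℕ) :
    ‖(memTraj G x0 p α w (k + 1)).x - (memTraj G x0 p α w k).x‖ ≤ memEta p α k := by
  simp only [memTraj, memRun, memStep, sub_sub_cancel_left, norm_neg]
  rw [norm_smul, norm_div, norm_norm, Real.norm_of_nonneg (memEta_pos k).le]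
  rw [div_mul_eq_mul_div]
  exact div_le_of_le_mul₀ (norm_nonneg _) (memEta_pos k).le le_rfl

/-- The constant `2 p ^ (2 p) L_p / p!`, which times `η_k ^ p / γ_k ^ (p - 1)` bounds the bias of
the momentum. -/
noncomputable def memBiasConst (p : ℕ) (Lp : ℝ) : ℝ :=
  2 * (p : ℝ) ^ (2 * p) * Lp / (p.factorial : ℝ)

lemma memBiasConst_nonneg {Lp : ℝ} (hL : 0 ≤ Lp) : 0 ≤ memBiasConst p Lp := by
  unfold memBiasConst
  positivity

/-- Seen from `x^k`, the extrapolated points of iteration `k + 1` are `x^k + (t² / γ_k) v` with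
`v = x^{k+1} - x^k`, so the drift is the contracted old error plus the extrapolation bias. -/
lemma norm_memDrift_succ_sub_le {Lp : ℝ} (hs : HighSmoothAssumption f p Lp) (h1 : 1 < α)
    (w : ℕ → ℕ → Ξ) (k : ℕ) :
    ‖memDrift f (p - 1) (memGamma p α) (memTheta p α) (k + 1) (memTraj G x0 p α w (k + 1))
      - (1 - ∑ t ∈ Finset.Icc 1 (p - 1), memTheta p α k t) • memErr f G x0 p α w k‖
      ≤ memBiasConst p Lp * (memEta p α k ^ p / memBaseGamma p α k ^ (p - 1)) := by
  obtain ⟨q, rfl⟩ : ∃ q, p = q + 1 := ⟨p - 1, by have := hs.two_le; omega⟩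
  have hp := hs.two_le
  have hc0 := memBaseGamma_pos (p := q + 1) (α := α) k
  have hc1 := memBaseGamma_lt_one hp h1 k
  set s := memTraj G x0 (q + 1) α w k with hsdef
  set s' := memTraj G x0 (q + 1) α w (k + 1) with hs'def
  set v := s'.x - s.x with hv
  have hsp : s'.xPrev = s.x := rfl
  have hsm : s'.mPrev = memDir G (q + 1 - 1) (memGamma (q + 1) α) (memTheta (q + 1) α) k (w k) s :=
    rfl
  have hz : ∀ t ∈ Finset.Icc 1 q, memZ (memGamma (q + 1) α) (k + 1) t s'
      = s.x + ((t : ℝ) ^ 2 / memBaseGamma (q + 1) α k) • v := fun t ht => by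
    have htp : (0 : ℝ) < (t : ℝ) := by exact_mod_cast (Finset.mem_Icc.1 ht).1
    have hg : memGamma (q + 1) α k t ≠ 0 := by
      unfold memGamma
      positivity
    unfold memZ memPrevGamma
    rw [hsp, ← hv, ← inv_memGamma, sub_div, div_self hg, sub_smul, one_smul, one_div]
    rw [hv]
    abel
  have hV := norm_extrapolation_bias_le (f := f) (q := q) (by omega) hs.contDiff hs.lipschitz
    (S := Finset.Icc 1 q) (θ := extrapWeight q (memBaseGamma (q + 1) α k))
    (τ := fun t => (t : ℝ) ^ 2 / memBaseGamma (q + 1) α k)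
    (fun t ht => by
      have htp : (0 : ℝ) < (t : ℝ) := by exact_mod_cast (Finset.mem_Icc.1 ht).1
      positivity)
    (fun r hr => sum_extrapWeight_mul_pow q hc0.ne' hr) s.x v
  have e : memDrift f (q + 1 - 1) (memGamma (q + 1) α) (memTheta (q + 1) α) (k + 1) s'
      - (1 - ∑ t ∈ Finset.Icc 1 (q + 1 - 1), memTheta (q + 1) α k t) • memErr f G x0 (q + 1) α w k
      = (1 - ∑ t ∈ Finset.Icc 1 q, extrapWeight q (memBaseGamma (q + 1) α k) t) • gradient f s.x
        + ∑ t ∈ Finset.Icc 1 q, extrapWeight q (memBaseGamma (q + 1) α k) t •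
          gradient f (s.x + ((t : ℝ) ^ 2 / memBaseGamma (q + 1) α k) • v)
        - gradient f (s.x + v) := by
    rw [memErr, ← hsdef, memDrift, hsm, smul_sub]
    simp only [memPrevTheta, memTheta_eq, Nat.add_sub_cancel]
    have hsum : ∑ t ∈ Finset.Icc 1 q, extrapWeight q (memBaseGamma (q + 1) α k) t •
          gradient f (memZ (memGamma (q + 1) α) (k + 1) t s')
        = ∑ t ∈ Finset.Icc 1 q, extrapWeight q (memBaseGamma (q + 1) α k) t •
          gradient f (s.x + ((t : ℝ) ^ 2 / memBaseGamma (q + 1) α k) • v) :=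
      Finset.sum_congr rfl fun t ht => by rw [hz t ht]
    rw [hsum, hv, add_sub_cancel]
    abel
  rw [e]
  refine hV.trans ?_
  have hη := norm_memTraj_succ_sub_le (G := G) (x0 := x0) (p := q + 1) (α := α) w k
  rw [← hsdef, ← hs'def, ← hv] at hη
  have hL := hs.Lp_pos
  calc Lp * ‖v‖ ^ (q + 1) / (q.factorial : ℝ) * (1 + ∑ t ∈ Finset.Icc 1 q,
        |extrapWeight q (memBaseGamma (q + 1) α k) t|
          * ((t : ℝ) ^ 2 / memBaseGamma (q + 1) α k) ^ (q + 1))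
      ≤ Lp * memEta (q + 1) α k ^ (q + 1) / (q.factorial : ℝ) *
        (2 * ((q : ℝ) + 1) ^ (2 * q + 1) / memBaseGamma (q + 1) α k ^ q) := by
        have := one_add_sum_abs_extrapWeight_mul_pow_le (q := q) hc0 hc1
        have hη0 := memEta_pos (p := q + 1) (α := α) k
        have hnn : 0 ≤ 1 + ∑ t ∈ Finset.Icc 1 q, |extrapWeight q (memBaseGamma (q + 1) α k) t|
          * ((t : ℝ) ^ 2 / memBaseGamma (q + 1) α k) ^ (q + 1) := by positivity
        gcongr
    _ = _ := by
        rw [memBiasConst, Nat.factorial_succ, Nat.add_sub_cancel]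
        push_cast
        field_simp
        ring

end Trajectory

/-! ### Moments of the momentum error along the run -/

section Moments

variable {n : ℕ} {Ξ Ω : Type*} [MeasurableSpace Ξ] [MeasurableSpace Ω]
  {f : EuclideanSpace ℝ (Fin n) → ℝ}
  {G : EuclideanSpace ℝ (Fin n) → Ξ → EuclideanSpace ℝ (Fin n)} {D : Measure Ξ}
  [IsProbabilityMeasure D] {P : Measure Ω} [IsProbabilityMeasure P]
  {flow L₁ σ α Lp : ℝ} {p : ℕ} {x0 : EuclideanSpace ℝ (Fin n)} {ξ : ℕ → ℕ → Ω → Ξ}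

lemma measurable_memTraj (hG : Measurable (Function.uncurry G))
    (hξ : ∀ k t, Measurable (ξ k t)) (k : ℕ) :
    Measurable fun ω => (memTraj G x0 p α (fun k t => ξ k t ω) k).toProd :=
  measurable_memRun_ambient hG x0 (p - 1) (memEta p α) (memGamma p α) (memTheta p α)
    (X := fun k ω t => ξ k t ω) (fun k => measurable_pi_lambda _ (hξ k)) k

/-- The error of iteration `k` is the drift, a function of the past, plus fresh noise. -/
lemma integrable_and_integral_memErr_rpow_le (h : BasicAssumption f G D flow L₁ σ α) (hp : 2 ≤ p)
    (hξ : ∀ k t, Measurable (ξ k t)) (hlaw : ∀ k t, P.map (ξ k t) = D)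
    (hind : iIndepFun (fun k ω t => ξ k t ω) P) (k : ℕ) {C : ℝ} (hC0 : 0 ≤ C)
    (hC : ∀ t ∈ Finset.Icc 1 (p - 1), |memPrevTheta (p - 1) (memTheta p α) k t| ≤ C)
    (hA : Integrable (fun ω => ‖memDrift f (p - 1) (memGamma p α) (memTheta p α) k
      (memTraj G x0 p α (fun k t => ξ k t ω) k)‖ ^ α) P) :
    Integrable (fun ω => ‖memErr f G x0 p α (fun k t => ξ k t ω) k‖ ^ α) P ∧
      ∫ ω, ‖memErr f G x0 p α (fun k t => ξ k t ω) k‖ ^ α ∂P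
        ≤ ∫ ω, ‖memDrift f (p - 1) (memGamma p α) (memTheta p α) k
            (memTraj G x0 p α (fun k t => ξ k t ω) k)‖ ^ α ∂P
          + 6 * (((p : ℝ) - 1) ^ α * C ^ α * σ ^ α) := by
  have hX : ∀ k, Measurable fun ω t => ξ k t ω := fun k => measurable_pi_lambda _ (hξ k)
  have hν : ∀ t, (P.map fun ω t => ξ k t ω).map (fun w => w t) = D := fun t => by
    rw [Measure.map_map (measurable_pi_apply t) (hX k)]
    exact hlaw k t
  have hne : (Finset.Icc 1 (p - 1)).Nonempty := ⟨1, Finset.mem_Icc.2 ⟨le_rfl, by omega⟩⟩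
  have hcard : ((Finset.Icc 1 (p - 1)).card : ℝ) = (p : ℝ) - 1 := by
    rw [Nat.card_Icc, Nat.add_sub_cancel, Nat.cast_sub (by omega), Nat.cast_one]
  have hσ := h.σ_pos
  have hp1 : (0 : ℝ) ≤ (p : ℝ) - 1 := by
    rw [← hcard]
    positivity
  have key := integrable_and_integral_norm_add_noise_rpow_le h.α_gt_one h.α_le_two
    (measurable_memTraj (x0 := x0) (p := p) (α := α) h.measurable_G hξ k) (hX k)
    (indepFun_memRun h.measurable_G x0 (p - 1) (memEta p α) (memGamma p α) (memTheta p α)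
      hX hind k)
    (A := fun a => memDrift f (p - 1) (memGamma p α) (memTheta p α) k (MemState.ofProd a))
    (N := fun a => memNoise f G (Finset.Icc 1 (p - 1)) (memPrevTheta (p - 1) (memTheta p α) k)
      fun t => memZ (memGamma p α) k t (MemState.ofProd a))
    (V := ((p : ℝ) - 1) ^ α * C ^ α * σ ^ α)
    (measurable_memDrift h.continuous_gradient _ _ _ k)
    (measurable_memNoise h.measurable_G h.continuous_gradient _ _ _ k)
    (by positivity) (fun a => integrable_memNoise h hν) (fun a => integral_memNoise h hν)
    (fun a => integrable_memNoise_rpow h hν hC)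
    (fun a => hcard ▸ integral_memNoise_rpow_le h hν hC0 hC hne) hA
  have e : ∀ ω, memErr f G x0 p α (fun k t => ξ k t ω) k = _ := fun ω =>
    memDir_sub_gradient (f := f) (G := G) (p - 1) (memGamma p α) (memTheta p α) k
      (fun t => ξ k t ω) (memTraj G x0 p α (fun k t => ξ k t ω) k)
  simp only [e]
  exact key

/-- At `k = 0` all extrapolated points equal `x^0` and the weights sum to `1`, so there is no
drift. -/
lemma memErr_zero_moment (h : BasicAssumption f G D flow L₁ σ α) (hp : 2 ≤ p)
    (hξ : ∀ k t, Measurable (ξ k t)) (hlaw : ∀ k t, P.map (ξ k t) = D)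
    (hind : iIndepFun (fun k ω t => ξ k t ω) P) :
    Integrable (fun ω => ‖memErr f G x0 p α (fun k t => ξ k t ω) 0‖ ^ α) P ∧
      ∫ ω, ‖memErr f G x0 p α (fun k t => ξ k t ω) 0‖ ^ α ∂P ≤ 6 * σ ^ α := by
  have hα : 0 < α := by linarith [h.α_gt_one]
  have hq : (0 : ℝ) < (p - 1 : ℕ) := by
    have : 0 < p - 1 := by omega
    exact_mod_cast this
  have hq' : ((p - 1 : ℕ) : ℝ) = (p : ℝ) - 1 := by
    rw [Nat.cast_sub (by omega), Nat.cast_one]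
  have hdrift : ∀ w : ℕ → ℕ → Ξ, memDrift f (p - 1) (memGamma p α) (memTheta p α) 0
      (memTraj G x0 p α w 0) = 0 := fun w => by
    simp only [memDrift, memRun, memPrevTheta, memZ, memPrevGamma, smul_zero, zero_add, sub_self,
      add_zero, zero_div, Finset.sum_const, Nat.card_Icc, Nat.add_sub_cancel]
    rw [← Nat.cast_smul_eq_nsmul ℝ, smul_smul, mul_one_div_cancel hq.ne', one_smul, sub_self]
  have hdrift' : ∀ w : ℕ → ℕ → Ξ, ‖memDrift f (p - 1) (memGamma p α) (memTheta p α) 0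
      (memTraj G x0 p α w 0)‖ ^ α = 0 := fun w => by
    rw [hdrift, norm_zero, Real.zero_rpow hα.ne']
  have key := integrable_and_integral_memErr_rpow_le (x0 := x0) h hp hξ hlaw hind 0
    (C := 1 / ((p - 1 : ℕ) : ℝ)) (by positivity)
    (fun t _ => le_of_eq (abs_of_nonneg (one_div_nonneg.2 hq.le)))
    (by
      simp only [hdrift']
      exact integrable_zero _ _ _)
  simp only [hdrift', integral_zero, zero_add] at key
  rwa [← hq', ← Real.mul_rpow hq.le (by positivity), mul_one_div_cancel hq.ne', Real.one_rpow,
    one_mul] at key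

/-- Recursion for the `α`-th moment of the momentum error: contraction by `1 - γ_k`, bias and
noise. -/
lemma memErr_succ_moment (h : BasicAssumption f G D flow L₁ σ α) (hs : HighSmoothAssumption f p Lp)
    (hξ : ∀ k t, Measurable (ξ k t)) (hlaw : ∀ k t, P.map (ξ k t) = D)
    (hind : iIndepFun (fun k ω t => ξ k t ω) P) (k : ℕ)
    (hk : Integrable (fun ω => ‖memErr f G x0 p α (fun k t => ξ k t ω) k‖ ^ α) P) :
    Integrable (fun ω => ‖memErr f G x0 p α (fun k t => ξ k t ω) (k + 1)‖ ^ α) P ∧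
      ∫ ω, ‖memErr f G x0 p α (fun k t => ξ k t ω) (k + 1)‖ ^ α ∂P
        ≤ (1 - memBaseGamma p α k) * ∫ ω, ‖memErr f G x0 p α (fun k t => ξ k t ω) k‖ ^ α ∂P
          + memBaseGamma p α k ^ (1 - α) * (memBiasConst p Lp
              * (memEta p α k ^ p / memBaseGamma p α k ^ (p - 1))) ^ α
          + 6 * (((p : ℝ) - 1) ^ α * (2 * memBaseGamma p α k) ^ α * σ ^ α) := by
  have hp := hs.two_le
  have h1 := h.α_gt_one
  have hc0 := memBaseGamma_pos (p := p) (α := α) k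
  have hc1 := memBaseGamma_lt_one hp h1 k
  set c := memBaseGamma p α k with hc
  set B := memBiasConst p Lp * (memEta p α k ^ p / c ^ (p - 1)) with hB
  have hΘ : c ≤ ∑ t ∈ Finset.Icc 1 (p - 1), memTheta p α k t :=
    le_sum_extrapWeight (by omega) hc0 hc1
  have hΘ1 : ∑ t ∈ Finset.Icc 1 (p - 1), memTheta p α k t < 1 :=
    sum_extrapWeight_lt_one (p - 1) hc0 hc1
  set Θ := ∑ t ∈ Finset.Icc 1 (p - 1), memTheta p α k t with hΘdef
  have hpt : ∀ w : ℕ → ℕ → Ξ, ‖memDrift f (p - 1) (memGamma p α) (memTheta p α) (k + 1)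
      (memTraj G x0 p α w (k + 1))‖ ^ α
      ≤ (1 - c) * ‖memErr f G x0 p α w k‖ ^ α + c ^ (1 - α) * B ^ α := fun w => by
    have hb := norm_memDrift_succ_sub_le (G := G) (x0 := x0) hs h1 w k
    rw [← hΘdef, ← hc, ← hB] at hb
    have e := add_sub_cancel ((1 - Θ) • memErr f G x0 p α w k)
      (memDrift f (p - 1) (memGamma p α) (memTheta p α) (k + 1) (memTraj G x0 p α w (k + 1)))
    rw [← e]
    refine (norm_contraction_add_rpow_le h1 (hc0.trans_le hΘ) hΘ1 _ _).trans ?_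
    refine add_le_add (mul_le_mul_of_nonneg_right (by linarith) (by positivity)) ?_
    exact mul_le_mul (Real.rpow_le_rpow_of_nonpos hc0 hΘ (by linarith))
      (Real.rpow_le_rpow (norm_nonneg _) hb (by linarith)) (by positivity) (by positivity)
  have hi : Integrable (fun ω => (1 - c) * ‖memErr f G x0 p α (fun k t => ξ k t ω) k‖ ^ α
      + c ^ (1 - α) * B ^ α) P := (hk.const_mul _).add (integrable_const _)
  have hA : Integrable (fun ω => ‖memDrift f (p - 1) (memGamma p α) (memTheta p α) (k + 1)
      (memTraj G x0 p α (fun k t => ξ k t ω) (k + 1))‖ ^ α) P := by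
    refine hi.mono' ?_ (Filter.Eventually.of_forall fun ω => ?_)
    · exact ((((measurable_memDrift h.continuous_gradient _ _ _ (k + 1)).comp
        (measurable_memTraj h.measurable_G hξ (k + 1))).norm).pow_const α).aestronglyMeasurable
    · rw [Real.norm_of_nonneg (by positivity)]
      exact hpt _
  have key := integrable_and_integral_memErr_rpow_le h hp hξ hlaw hind (k + 1) (C := 2 * c)
    (by positivity) (fun t ht => abs_extrapWeight_le_two_mul hc0 hc1 ht) hA
  refine ⟨key.1, key.2.trans (add_le_add ?_ le_rfl)⟩
  calc _ ≤ ∫ ω, ((1 - c) * ‖memErr f G x0 p α (fun k t => ξ k t ω) k‖ ^ α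
      + c ^ (1 - α) * B ^ α) ∂P := integral_mono hA hi fun ω => hpt _
    _ = _ := by
      rw [integral_add (hk.const_mul _) (integrable_const _), integral_const_mul]
      simp

lemma integrable_memErr_rpow (h : BasicAssumption f G D flow L₁ σ α)
    (hs : HighSmoothAssumption f p Lp)
    (hξ : ∀ k t, Measurable (ξ k t)) (hlaw : ∀ k t, P.map (ξ k t) = D)
    (hind : iIndepFun (fun k ω t => ξ k t ω) P) (k : ℕ) :
    Integrable (fun ω => ‖memErr f G x0 p α (fun k t => ξ k t ω) k‖ ^ α) P := by
  induction k with
  | zero => exact (memErr_zero_moment h hs.two_le hξ hlaw hind).1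
  | succ k ih => exact (memErr_succ_moment h hs hξ hlaw hind k ih).1

/-- The weighted recursion. The weight grows by a factor of at most `1 + γ_k / 3`, so the
contraction leaves a multiple of `γ_k` times the moment; bias and noise both become multiples of
`1 / (k + 4)`. -/
lemma potWeight_mul_memErr_succ_le (h : BasicAssumption f G D flow L₁ σ α)
    (hs : HighSmoothAssumption f p Lp)
    (hξ : ∀ k t, Measurable (ξ k t)) (hlaw : ∀ k t, P.map (ξ k t) = D)
    (hind : iIndepFun (fun k ω t => ξ k t ω) P) (k : ℕ) :
    memBaseGamma p α k * potWeight p α k / 30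
        * ∫ ω, ‖memErr f G x0 p α (fun k t => ξ k t ω) k‖ ^ α ∂P
      + potWeight p α (k + 1) * ∫ ω, ‖memErr f G x0 p α (fun k t => ξ k t ω) (k + 1)‖ ^ α ∂P
      ≤ potWeight p α k * ∫ ω, ‖memErr f G x0 p α (fun k t => ξ k t ω) k‖ ^ α ∂P
        + (2 * memBiasConst p Lp ^ α + 48 * (((p : ℝ) - 1) ^ α * σ ^ α)) * (1 / ((k : ℝ) + 4)) := by
  have hp := hs.two_le
  have h1 := h.α_gt_one
  have h2 := h.α_le_two
  have hα : 0 ≤ α := by linarith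
  have hp1 : (0 : ℝ) ≤ (p : ℝ) - 1 := by
    have : (2 : ℝ) ≤ p := by exact_mod_cast hp
    linarith
  have hσ := h.σ_pos
  have hBc := memBiasConst_nonneg (p := p) hs.Lp_pos.le
  have hη0 := memEta_pos (p := p) (α := α) k
  have hrec := (memErr_succ_moment (x0 := x0) h hs hξ hlaw hind k
    (integrable_memErr_rpow h hs hξ hlaw hind k)).2
  have ha : 0 ≤ ∫ ω, ‖memErr f G x0 p α (fun k t => ξ k t ω) k‖ ^ α ∂P :=
    integral_nonneg fun ω => by positivity
  set a := ∫ ω, ‖memErr f G x0 p α (fun k t => ξ k t ω) k‖ ^ α ∂P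
  set a' := ∫ ω, ‖memErr f G x0 p α (fun k t => ξ k t ω) (k + 1)‖ ^ α ∂P
  have hw := potWeight_pos (p := p) (α := α) k
  have hw' := potWeight_pos (p := p) (α := α) (k + 1)
  have hc0 := memBaseGamma_pos (p := p) (α := α) k
  have hc1 := memBaseGamma_lt_one hp h1 k
  have e1 := potWeight_mul_bias (p := p) hp h1 k
  have e2 := potWeight_mul_memBaseGamma_rpow (p := p) (α := α) k
  have g1 := potWeight_succ_le hp h1 h2 k
  have g2 := potWeight_succ_le_two_mul hp h1 h2 k
  have h2α : (2 : ℝ) ^ α ≤ 4 := by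
    calc (2 : ℝ) ^ α ≤ 2 ^ (2 : ℝ) := Real.rpow_le_rpow_of_exponent_le (by norm_num) h2
      _ = 4 := by norm_num
  rw [Real.mul_rpow hBc (by positivity), Real.mul_rpow zero_le_two hc0.le] at hrec
  set c := memBaseGamma p α k
  set w := potWeight p α k
  set w' := potWeight p α (k + 1)
  set y := 1 / ((k : ℝ) + 4)
  set u := c ^ (1 - α) * (memEta p α k ^ p / c ^ (p - 1)) ^ α with hu
  set s := ((p : ℝ) - 1) ^ α * σ ^ α with hsdef
  have hs0 : 0 ≤ s := by positivity
  have hu0 : 0 ≤ u := by positivity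
  have hBα : 0 ≤ memBiasConst p Lp ^ α := by positivity
  have hcα : 0 ≤ c ^ α := by positivity
  have hrec' : a' ≤ (1 - c) * a + (memBiasConst p Lp ^ α * u + 24 * (c ^ α * s)) := by
    refine hrec.trans ?_
    have : 6 * (((p : ℝ) - 1) ^ α * (2 ^ α * c ^ α) * σ ^ α) ≤ 24 * (c ^ α * s) := by
      have := mul_le_mul_of_nonneg_right h2α (mul_nonneg hcα hs0)
      calc _ = 6 * (2 ^ α * (c ^ α * s)) := by rw [hsdef]; ring
        _ ≤ _ := by linarith
    calc _ = (1 - c) * a + memBiasConst p Lp ^ α * u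
          + 6 * (((p : ℝ) - 1) ^ α * (2 ^ α * c ^ α) * σ ^ α) := by rw [hu]; ring
      _ ≤ _ := by linarith
  have t1 : w' * ((1 - c) * a) ≤ w * (1 - c / 30) * a := by
    have : w' * (1 - c) ≤ w * (1 - c / 30) := by
      calc w' * (1 - c) ≤ w * (1 + c / 3) * (1 - c) :=
            mul_le_mul_of_nonneg_right g1 (by linarith)
        _ ≤ w * (1 - c / 30) := by
            rw [mul_assoc]
            refine mul_le_mul_of_nonneg_left ?_ hw.le
            nlinarith [sq_nonneg c]
    calc w' * ((1 - c) * a) = w' * (1 - c) * a := by ring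
      _ ≤ _ := mul_le_mul_of_nonneg_right this ha
  have t2 : w' * (memBiasConst p Lp ^ α * u + 24 * (c ^ α * s))
      ≤ (2 * memBiasConst p Lp ^ α + 48 * s) * y := by
    calc _ ≤ 2 * w * (memBiasConst p Lp ^ α * u + 24 * (c ^ α * s)) :=
          mul_le_mul_of_nonneg_right g2 (by positivity)
      _ = 2 * memBiasConst p Lp ^ α * (w * u) + 48 * s * (w * c ^ α) := by ring
      _ = _ := by
          rw [e1, e2]
          ring
  have t3 := mul_le_mul_of_nonneg_left hrec' hw'.le
  rw [mul_add] at t3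
  linarith

/-- Summing the weighted recursion over the first `K` iterations. -/
lemma sum_memErr_le (h : BasicAssumption f G D flow L₁ σ α)
    (hs : HighSmoothAssumption f p Lp)
    (hξ : ∀ k t, Measurable (ξ k t)) (hlaw : ∀ k t, P.map (ξ k t) = D)
    (hind : iIndepFun (fun k ω t => ξ k t ω) P) {K : ℕ} (hK : 5 ≤ K) :
    ∑ k ∈ Finset.range K, memBaseGamma p α k * potWeight p α k / 30
        * ∫ ω, ‖memErr f G x0 p α (fun k t => ξ k t ω) k‖ ^ α ∂P
      ≤ 6 * ((4 : ℝ) ^ (1 / 3 : ℝ) * σ ^ α)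
        + (2 * memBiasConst p Lp ^ α + 48 * (((p : ℝ) - 1) ^ α * σ ^ α)) * Real.log K := by
  have hp := hs.two_le
  have hp1 : (0 : ℝ) ≤ (p : ℝ) - 1 := by
    have : (2 : ℝ) ≤ p := by exact_mod_cast hp
    linarith
  have hσ := h.σ_pos
  have hBc := memBiasConst_nonneg (p := p) hs.Lp_pos.le
  set C := 2 * memBiasConst p Lp ^ α + 48 * (((p : ℝ) - 1) ^ α * σ ^ α) with hC
  have hC0 : 0 ≤ C := by positivity
  have hsum : ∀ K : ℕ, ∑ k ∈ Finset.range K, memBaseGamma p α k * potWeight p α k / 30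
        * ∫ ω, ‖memErr f G x0 p α (fun k t => ξ k t ω) k‖ ^ α ∂P
      + potWeight p α K * ∫ ω, ‖memErr f G x0 p α (fun k t => ξ k t ω) K‖ ^ α ∂P
      ≤ potWeight p α 0 * ∫ ω, ‖memErr f G x0 p α (fun k t => ξ k t ω) 0‖ ^ α ∂P
        + C * ∑ k ∈ Finset.range K, 1 / ((k : ℝ) + 4) := fun K => by
    induction K with
    | zero => simp
    | succ K ih =>
      rw [Finset.sum_range_succ, Finset.sum_range_succ, mul_add]
      have := potWeight_mul_memErr_succ_le (x0 := x0) h hs hξ hlaw hind K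
      linarith
  have h0 : potWeight p α 0 * ∫ ω, ‖memErr f G x0 p α (fun k t => ξ k t ω) 0‖ ^ α ∂P
      ≤ (4 : ℝ) ^ (1 / 3 : ℝ) * (6 * σ ^ α) :=
    mul_le_mul (potWeight_zero_le hp h.α_gt_one h.α_le_two)
      (memErr_zero_moment h hp hξ hlaw hind).2 (integral_nonneg fun ω => by positivity)
      (by positivity)
  have hlast : 0 ≤ potWeight p α K * ∫ ω, ‖memErr f G x0 p α (fun k t => ξ k t ω) K‖ ^ α ∂P :=
    mul_nonneg (potWeight_pos K).le (integral_nonneg fun ω => by positivity)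
  have hlog := mul_le_mul_of_nonneg_left (sum_inv_le_log hK) hC0
  have := hsum K
  linarith

end Moments

/-! ### Expected weighted sum of gradient norms -/

section Convergence

/-- The additive constant that Young's inequality produces in every iteration when `2 η_k ‖e^k‖` is
absorbed into `γ_k / 30` times the weighted `α`-th power of `‖e^k‖`. -/
noncomputable def memYoungConst (α : ℝ) : ℝ :=
  (30 : ℝ) ^ (1 / (α - 1)) * (α - 1) * (2 / α) ^ (α / (α - 1))

lemma two_mul_memEta_mul_le {p : ℕ} {α : ℝ} (hp : 2 ≤ p) (h1 : 1 < α) (k : ℕ) {e : ℝ}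
    (he : 0 ≤ e) :
    2 * memEta p α k * e ≤ memBaseGamma p α k * potWeight p α k / 30 * e ^ α
      + memYoungConst α * (1 / ((k : ℝ) + 4)) := by
  have hy : (0 : ℝ) < (k : ℝ) + 4 := by positivity
  have hc := mul_pos (memBaseGamma_pos (p := p) (α := α) k) (potWeight_pos (p := p) (α := α) k)
  refine (two_mul_mul_le_young h1 (memEta_pos k).le (by linarith : 0 <
    memBaseGamma p α k * potWeight p α k / 30) he).trans (le_of_eq ?_)
  have e1 : memEta p α k ^ α / (memBaseGamma p α k * potWeight p α k / 30)
      = 30 * ((k : ℝ) + 4) ^ (-(α - 1)) := by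
    rw [← memEta_rpow_div hp h1 k]
    field_simp
  have e2 : (((k : ℝ) + 4) ^ (-(α - 1))) ^ (1 / (α - 1)) = 1 / ((k : ℝ) + 4) := by
    have : α - 1 ≠ 0 := by linarith
    rw [← Real.rpow_mul hy.le, neg_mul, mul_one_div_cancel this, Real.rpow_neg_one, one_div]
  rw [e1, Real.mul_rpow (by norm_num) (by positivity), e2, memYoungConst]
  ring

variable {n : ℕ} {Ξ Ω : Type*} [MeasurableSpace Ξ] [MeasurableSpace Ω]
  {f : EuclideanSpace ℝ (Fin n) → ℝ}
  {G : EuclideanSpace ℝ (Fin n) → Ξ → EuclideanSpace ℝ (Fin n)} {D : Measure Ξ}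
  {P : Measure Ω}
  {flow L₁ σ α Lp : ℝ} {p : ℕ} {x0 : EuclideanSpace ℝ (Fin n)} {ξ : ℕ → ℕ → Ω → Ξ}

lemma norm_memTraj_sub_le {Ξ : Type*}
    {G : EuclideanSpace ℝ (Fin n) → Ξ → EuclideanSpace ℝ (Fin n)} (w : ℕ → ℕ → Ξ) (k : ℕ) :
    ‖(memTraj G x0 p α w k).x - x0‖ ≤ ∑ j ∈ Finset.range k, memEta p α j := by
  induction k with
  | zero => simp [memRun]
  | succ k ih =>
    rw [Finset.sum_range_succ]
    have h1 := norm_memTraj_succ_sub_le (G := G) (x0 := x0) (p := p) (α := α) w k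
    have h2 := norm_add_le ((memTraj G x0 p α w k).x - x0)
      ((memTraj G x0 p α w (k + 1)).x - (memTraj G x0 p α w k).x)
    rw [add_comm, sub_add_sub_cancel] at h2
    linarith

/-- The iterates of a normalized method are deterministically bounded, hence so are the gradients
along the run. -/
lemma norm_gradient_memTraj_le (h : BasicAssumption f G D flow L₁ σ α) (w : ℕ → ℕ → Ξ) (k : ℕ) :
    ‖gradient f (memTraj G x0 p α w k).x‖
      ≤ ‖gradient f x0‖ + L₁ * ∑ j ∈ Finset.range k, memEta p α j := by
  have h1 := h.gradient_lipschitz (memTraj G x0 p α w k).x x0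
  have h2 := mul_le_mul_of_nonneg_left
    (norm_memTraj_sub_le (G := G) (x0 := x0) (p := p) (α := α) w k) h.L₁_pos.le
  have h3 := norm_sub_norm_le (gradient f (memTraj G x0 p α w k).x) (gradient f x0)
  linarith

lemma measurable_norm_gradient_memTraj (h : BasicAssumption f G D flow L₁ σ α)
    (hξ : ∀ k t, Measurable (ξ k t)) (k : ℕ) :
    Measurable fun ω => ‖gradient f (memTraj G x0 p α (fun k t => ξ k t ω) k).x‖ :=
  (h.continuous_gradient.measurable.comp
    ((measurable_fst.comp measurable_snd).comp (measurable_memTraj h.measurable_G hξ k))).norm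

lemma integrable_norm_gradient_memTraj [IsProbabilityMeasure P]
    (h : BasicAssumption f G D flow L₁ σ α) (hξ : ∀ k t, Measurable (ξ k t)) (k : ℕ) :
    Integrable (fun ω => ‖gradient f (memTraj G x0 p α (fun k t => ξ k t ω) k).x‖) P :=
  Integrable.of_bound (measurable_norm_gradient_memTraj h hξ k).aestronglyMeasurable
    (‖gradient f x0‖ + L₁ * ∑ j ∈ Finset.range k, memEta p α j)
    (Filter.Eventually.of_forall fun ω => by
      rw [norm_norm]
      exact norm_gradient_memTraj_le h _ k)

/-- The descent estimates of the first `K` iterations, telescoped along a single run. -/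
lemma sum_memEta_mul_norm_gradient_le (h : BasicAssumption f G D flow L₁ σ α) (w : ℕ → ℕ → Ξ)
    (K : ℕ) :
    ∑ k ∈ Finset.range K, memEta p α k * ‖gradient f (memTraj G x0 p α w k).x‖
      ≤ f x0 - flow + ∑ k ∈ Finset.range K,
        (2 * memEta p α k * ‖memErr f G x0 p α w k‖ + L₁ / 2 * memEta p α k ^ 2) := by
  have hsum : ∀ K : ℕ, f (memTraj G x0 p α w K).x
      + ∑ k ∈ Finset.range K, memEta p α k * ‖gradient f (memTraj G x0 p α w k).x‖
      ≤ f x0 + ∑ k ∈ Finset.range K,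
        (2 * memEta p α k * ‖memErr f G x0 p α w k‖ + L₁ / 2 * memEta p α k ^ 2) := fun K => by
    induction K with
    | zero => simp [memRun]
    | succ K ih =>
      rw [Finset.sum_range_succ, Finset.sum_range_succ]
      have hstep : f (memTraj G x0 p α w (K + 1)).x ≤ _ :=
        normalized_step_le h.differentiable h.L₁_pos.le h.gradient_lipschitz
          (memTraj G x0 p α w K).x
          (memDir G (p - 1) (memGamma p α) (memTheta p α) K (w K) (memTraj G x0 p α w K))
          (memEta_pos (p := p) (α := α) K).le
      rw [← memErr] at hstep
      linarith
  have := hsum K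
  have := h.lower_bound (memTraj G x0 p α w K).x
  linarith

lemma sum_memEta_mul_integral_norm_gradient_le [IsProbabilityMeasure D] [IsProbabilityMeasure P]
    (h : BasicAssumption f G D flow L₁ σ α) (hs : HighSmoothAssumption f p Lp)
    (hξ : ∀ k t, Measurable (ξ k t)) (hlaw : ∀ k t, P.map (ξ k t) = D)
    (hind : iIndepFun (fun k ω t => ξ k t ω) P) {K : ℕ} (hK : 5 ≤ K) :
    ∑ k ∈ Finset.range K,
        memEta p α k * ∫ ω, ‖gradient f (memTraj G x0 p α (fun k t => ξ k t ω) k).x‖ ∂P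
      ≤ f x0 - flow + 6 * ((4 : ℝ) ^ (1 / 3 : ℝ) * σ ^ α)
        + (2 * memBiasConst p Lp ^ α + 48 * (((p : ℝ) - 1) ^ α * σ ^ α)
          + memYoungConst α + L₁ / 2) * Real.log K := by
  have hp := hs.two_le
  have h1 := h.α_gt_one
  set c : ℕ → ℝ := fun k => memBaseGamma p α k * potWeight p α k / 30 with hc
  set b : ℕ → ℝ := fun k => (memYoungConst α + L₁ / 2) * (1 / ((k : ℝ) + 4)) with hb
  have hpath : ∀ w : ℕ → ℕ → Ξ,
      ∑ k ∈ Finset.range K, memEta p α k * ‖gradient f (memTraj G x0 p α w k).x‖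
      ≤ f x0 - flow + ∑ k ∈ Finset.range K, (c k * ‖memErr f G x0 p α w k‖ ^ α + b k) :=
    fun w => by
      refine (sum_memEta_mul_norm_gradient_le h w K).trans
        (add_le_add le_rfl (Finset.sum_le_sum fun k _ => ?_))
      have e1 := two_mul_memEta_mul_le hp h1 k (norm_nonneg (memErr f G x0 p α w k))
      have e2 := mul_le_mul_of_nonneg_left (memEta_sq_le hp h1 k) (half_pos h.L₁_pos).le
      simp only [hc, hb]
      linarith
  have hgi := fun k => integrable_norm_gradient_memTraj (P := P) (x0 := x0) (p := p) h hξ k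
  have hei := fun k => integrable_memErr_rpow (x0 := x0) h hs hξ hlaw hind k
  have hi : ∀ k ∈ Finset.range K, Integrable
      (fun ω => c k * ‖memErr f G x0 p α (fun k t => ξ k t ω) k‖ ^ α + b k) P := fun k _ =>
    ((hei k).const_mul _).add (integrable_const _)
  have hint : ∑ k ∈ Finset.range K,
        memEta p α k * ∫ ω, ‖gradient f (memTraj G x0 p α (fun k t => ξ k t ω) k).x‖ ∂P
      ≤ f x0 - flow + ∑ k ∈ Finset.range K,
        (c k * ∫ ω, ‖memErr f G x0 p α (fun k t => ξ k t ω) k‖ ^ α ∂P + b k) := by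
    calc _ = ∫ ω, ∑ k ∈ Finset.range K,
            memEta p α k * ‖gradient f (memTraj G x0 p α (fun k t => ξ k t ω) k).x‖ ∂P := by
          rw [integral_finsetSum _ fun k _ => (hgi k).const_mul _]
          exact Finset.sum_congr rfl fun k _ => (integral_const_mul _ _).symm
      _ ≤ ∫ ω, (f x0 - flow + ∑ k ∈ Finset.range K,
            (c k * ‖memErr f G x0 p α (fun k t => ξ k t ω) k‖ ^ α + b k)) ∂P :=
          integral_mono (integrable_finsetSum _ fun k _ => (hgi k).const_mul _)
            ((integrable_const _).add (integrable_finsetSum _ hi)) fun ω => hpath _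
      _ = _ := by
          rw [integral_add (integrable_const _) (integrable_finsetSum _ hi),
            integral_finsetSum _ hi]
          congr 1
          · simp
          · refine Finset.sum_congr rfl fun k _ => ?_
            rw [integral_add ((hei k).const_mul _) (integrable_const _), integral_const_mul]
            simp
  have hY : 0 ≤ memYoungConst α + L₁ / 2 := by
    have h3 : 0 < α - 1 := by linarith
    have h4 := h.L₁_pos
    have h5 : 0 ≤ 2 / α := by
      have : 0 < α := by linarith
      positivity
    unfold memYoungConst
    positivity
  have hsb := mul_le_mul_of_nonneg_left (sum_inv_le_log hK) hY
  rw [Finset.mul_sum] at hsb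
  have hse := sum_memErr_le (x0 := x0) h hs hξ hlaw hind hK
  rw [Finset.sum_add_distrib] at hint
  simp only [hc, hb] at hint
  linarith

/-! ### From the weighted sum to the iteration bound -/

lemma memBiasConst_rpow_le {Lp : ℝ} (hL : 0 ≤ Lp) (h2 : α ≤ 2) :
    memBiasConst p Lp ^ α
      ≤ 4 * ((p : ℝ) ^ (2 * α * p) * Lp ^ α / (p.factorial : ℝ) ^ α) := by
  have h2α : (2 : ℝ) ^ α ≤ 4 := by
    calc (2 : ℝ) ^ α ≤ 2 ^ (2 : ℝ) := Real.rpow_le_rpow_of_exponent_le (by norm_num) h2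
      _ = 4 := by norm_num
  have e : ((p : ℝ) ^ (2 * p)) ^ α = (p : ℝ) ^ (2 * α * p) := by
    rw [← Real.rpow_natCast_mul (by positivity)]
    congr 1
    push_cast
    ring
  rw [memBiasConst, Real.div_rpow (by positivity) (by positivity),
    Real.mul_rpow (by positivity) hL, Real.mul_rpow zero_le_two (by positivity), e, mul_div_assoc,
    mul_assoc, ← mul_div_assoc]
  exact mul_le_mul_of_nonneg_right h2α (by positivity)

lemma memYoungConst_ge (h1 : 1 < α) (h2 : α ≤ 2) : 29 ≤ memYoungConst α := by
  have h0 : 0 < α - 1 := by linarith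
  have h3 : 1 ≤ 1 / (α - 1) := (one_le_div h0).2 (by linarith)
  have h4 := one_add_mul_self_le_rpow_one_add (s := 29) (by norm_num) h3
  have h5 : 29 ≤ (30 : ℝ) ^ (1 / (α - 1)) * (α - 1) := by
    norm_num at h4
    have := mul_le_mul_of_nonneg_right h4 h0.le
    have e : (1 + (α - 1)⁻¹ * 29) * (α - 1) = α - 1 + 29 := by field_simp
    rw [one_div]
    linarith
  have h6 : 1 ≤ (2 / α) ^ (α / (α - 1)) :=
    Real.one_le_rpow ((one_le_div (by linarith)).2 h2) (by
      have : 0 < α := by linarith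
      positivity)
  unfold memYoungConst
  nlinarith

/-- The weighted sum is at most `M_{p,α} / 2 * log K`. -/
lemma sum_memEta_mul_integral_norm_gradient_le_memConst [IsProbabilityMeasure D]
    [IsProbabilityMeasure P]
    (h : BasicAssumption f G D flow L₁ σ α) (hs : HighSmoothAssumption f p Lp)
    (hξ : ∀ k t, Measurable (ξ k t)) (hlaw : ∀ k t, P.map (ξ k t) = D)
    (hind : iIndepFun (fun k ω t => ξ k t ω) P) {K : ℕ} (hK : 5 ≤ K) :
    ∑ k ∈ Finset.range K,
        memEta p α k * ∫ ω, ‖gradient f (memTraj G x0 p α (fun k t => ξ k t ω) k).x‖ ∂P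
      ≤ memConst p α σ L₁ Lp (f x0 - flow) / 2 * Real.log K := by
  refine (sum_memEta_mul_integral_norm_gradient_le h hs hξ hlaw hind hK).trans ?_
  have hlog : 1 ≤ Real.log K := by
    rw [Real.le_log_iff_exp_le (by positivity)]
    have : (5 : ℝ) ≤ K := by exact_mod_cast hK
    linarith [Real.exp_one_lt_d9]
  have hB := memBiasConst_rpow_le (p := p) hs.Lp_pos.le h.α_le_two
  have hY := memYoungConst_ge h.α_gt_one h.α_le_two
  have hΔ : 0 ≤ f x0 - flow := sub_nonneg.2 (h.lower_bound x0)
  have hp1 : (1 : ℝ) ≤ (p : ℝ) - 1 := by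
    have : (2 : ℝ) ≤ p := by exact_mod_cast hs.two_le
    linarith
  have hσ : 0 ≤ σ ^ α := by
    have := h.σ_pos
    positivity
  have h4 : (4 : ℝ) ^ (1 / 3 : ℝ) ≤ 4 :=
    (Real.rpow_le_rpow_of_exponent_le (by norm_num) (by norm_num)).trans (Real.rpow_one 4).le
  have hq : σ ^ α ≤ ((p : ℝ) - 1) ^ α * σ ^ α :=
    le_mul_of_one_le_left hσ (Real.one_le_rpow hp1 (by linarith [h.α_gt_one]))
  have h4σ : (4 : ℝ) ^ (1 / 3 : ℝ) * σ ^ α ≤ 4 * (((p : ℝ) - 1) ^ α * σ ^ α) :=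
    (mul_le_mul_of_nonneg_right h4 hσ).trans (by linarith)
  have h40 : 0 ≤ (4 : ℝ) ^ (1 / 3 : ℝ) * σ ^ α := by positivity
  have hb0 : 0 ≤ (p : ℝ) ^ (2 * α * p) * Lp ^ α / (p.factorial : ℝ) ^ α := by
    have := hs.Lp_pos
    positivity
  have hL := h.L₁_pos
  have e : memConst p α σ L₁ Lp (f x0 - flow) = 4 * ((f x0 - flow)
      + (4 : ℝ) ^ (1 / 3 : ℝ) * σ ^ α + L₁ / 2 + memYoungConst α
      + 306 * ((p : ℝ) ^ (2 * α * p) * Lp ^ α / (p.factorial : ℝ) ^ α)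
      + 64 * (((p : ℝ) - 1) ^ α * σ ^ α)) := by
    unfold memConst memYoungConst
    ring
  rw [e]
  set Δ := f x0 - flow
  set s4 := (4 : ℝ) ^ (1 / 3 : ℝ) * σ ^ α
  set s := ((p : ℝ) - 1) ^ α * σ ^ α
  set B := (p : ℝ) ^ (2 * α * p) * Lp ^ α / (p.factorial : ℝ) ^ α
  have hs0 : 0 ≤ s := hσ.trans hq
  calc Δ + 6 * s4 + (2 * memBiasConst p Lp ^ α + 48 * s + memYoungConst α + L₁ / 2) * Real.log K
      ≤ (Δ + 6 * s4) * Real.log K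
        + (2 * memBiasConst p Lp ^ α + 48 * s + memYoungConst α + L₁ / 2) * Real.log K := by
        have := le_mul_of_one_le_right (by positivity : 0 ≤ Δ + 6 * s4) hlog
        linarith
    _ = (Δ + 6 * s4 + (2 * memBiasConst p Lp ^ α + 48 * s + memYoungConst α + L₁ / 2))
          * Real.log K := by ring
    _ ≤ _ := by
        refine mul_le_mul_of_nonneg_right ?_ (by linarith)
        linarith

lemma memConst_ge (h : BasicAssumption f G D flow L₁ σ α) (hs : HighSmoothAssumption f p Lp) :
    4 ≤ memConst p α σ L₁ Lp (f x0 - flow) := by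
  have hY := memYoungConst_ge h.α_gt_one h.α_le_two
  have hΔ : 0 ≤ f x0 - flow := sub_nonneg.2 (h.lower_bound x0)
  have hp1 : (0 : ℝ) ≤ (p : ℝ) - 1 := by
    have : (2 : ℝ) ≤ p := by exact_mod_cast hs.two_le
    linarith
  have hσ := h.σ_pos
  have hL := h.L₁_pos
  have hLp := hs.Lp_pos
  have e1 : 0 ≤ (4 : ℝ) ^ (1 / 3 : ℝ) * σ ^ α := by positivity
  have e2 : 0 ≤ 306 * (p : ℝ) ^ (2 * α * p) * Lp ^ α / (p.factorial : ℝ) ^ α := by positivity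
  have e3 : 0 ≤ 64 * ((p : ℝ) - 1) ^ α * σ ^ α := by positivity
  unfold memConst
  rw [← memYoungConst]
  linarith

/-- If `u` is at least `X log X`, then `log u / u ≤ 2 / X`. The logarithm is bounded by its tangent
at `X log X`. -/
lemma half_mul_log_le {X u : ℝ} (hX : Real.exp 1 ≤ X) (hu : X * Real.log X ≤ u) :
    X / 2 * Real.log u ≤ u := by
  have hX0 : 0 < X := (Real.exp_pos 1).trans_le hX
  have hl : 1 ≤ Real.log X := (Real.le_log_iff_exp_le hX0).2 hX
  set v := X * Real.log X with hv
  have hv0 : 0 < v := by positivity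
  have hXv : X ≤ v := le_mul_of_one_le_right hX0.le hl
  have hu0 : 0 < u := hv0.trans_le hu
  have h1 : Real.log u ≤ Real.log v + (u / v - 1) := by
    have := Real.log_le_sub_one_of_pos (div_pos hu0 hv0)
    rw [Real.log_div hu0.ne' hv0.ne'] at this
    linarith
  have h2 : Real.log v ≤ 2 * Real.log X - 1 := by
    rw [hv, Real.log_mul hX0.ne' (by linarith)]
    have := Real.log_le_sub_one_of_pos (by linarith : 0 < Real.log X)
    linarith
  set r := u / v with hr
  have hur : u = v * r := by rw [hr, mul_div_cancel₀ _ hv0.ne']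
  have hr1 : 1 ≤ r := (one_le_div hv0).2 hu
  have h3 : X / 2 * Real.log u ≤ X / 2 * (2 * Real.log X - 1 + (r - 1)) :=
    mul_le_mul_of_nonneg_left (by linarith) (by positivity)
  have h4 : X * (r - 1) ≤ v * (r - 1) := mul_le_mul_of_nonneg_right hXv (by linarith)
  have h5 : X / 2 * (2 * Real.log X - 1 + (r - 1)) = v + X * (r / 2 - 1) := by
    rw [hv]
    ring
  rw [h5] at h3
  nlinarith

/-- The rate `M log K / K ^ β`, with `β = p (α - 1) / d`, is below `ε` for `K` beyond the bound. -/
lemma mul_log_le_of_memBound_le (hp : 2 ≤ p) (h1 : 1 < α) {M ε : ℝ} (hM : 4 ≤ M) (hε0 : 0 < ε)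
    (hε1 : ε < 1) {K : ℕ} (hK : memBound p α M ε ≤ K) :
    M * Real.log K ≤ ε * (K : ℝ) ^ (p * (α - 1) / memDen p α) := by
  have hd := memDen_pos hp h1
  have hp0 : (0 : ℝ) < p := by positivity
  have hα : 0 < α - 1 := by linarith
  set β := p * (α - 1) / memDen p α with hβ
  have hβ0 : 0 < β := by positivity
  have hβ1 : β ≤ 1 := by
    rw [hβ, div_le_one hd]
    unfold memDen
    nlinarith
  have hK5 : (5 : ℝ) ≤ K := (le_max_right _ _).trans hK
  have hK0 : (0 : ℝ) < K := by linarith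
  set X := 2 * memDen p α * M / (p * (α - 1) * ε) with hX
  have hXe : X = 2 * M / (β * ε) := by
    rw [hX, hβ]
    field_simp
  have hX8 : 8 ≤ X := by
    rw [hXe, le_div_iff₀ (by positivity)]
    have : β * ε ≤ 1 := mul_le_one₀ hβ1 hε0.le hε1.le
    linarith
  have hexp : Real.exp 1 ≤ X := by linarith [Real.exp_one_lt_d9]
  have hlog : 0 ≤ Real.log X := Real.log_nonneg (by linarith)
  have hinv : memDen p α / (p * (α - 1)) = 1 / β := by
    rw [hβ]
    field_simp
  have hKb : (X * Real.log X) ^ (1 / β) ≤ K := by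
    rw [← hinv]
    exact (le_max_left _ _).trans hK
  have hu : X * Real.log X ≤ (K : ℝ) ^ β := by
    have := Real.rpow_le_rpow (by positivity) hKb hβ0.le
    rwa [← Real.rpow_mul (by positivity), one_div_mul_cancel hβ0.ne', Real.rpow_one] at this
  have := half_mul_log_le hexp hu
  rw [Real.log_rpow hK0, hXe] at this
  have e : 2 * M / (β * ε) / 2 * (β * Real.log K) = M * Real.log K / ε := by
    field_simp
  rw [e, div_le_iff₀ hε0] at this
  linarith

lemma memEta_antitone (hp : 2 ≤ p) (h1 : 1 < α) {j k : ℕ} (hjk : j ≤ k) :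
    memEta p α k ≤ memEta p α j := by
  have hd := memDen_pos hp h1
  have hp0 : (0 : ℝ) < p := by positivity
  have hjk' : (j : ℝ) ≤ k := by exact_mod_cast hjk
  have hexp : 0 ≤ (p * α + α - 1) / memDen p α := by
    refine div_nonneg ?_ hd.le
    nlinarith
  unfold memEta
  gcongr

/-- `K η_{K - 1} ≥ K ^ β / 2` with `β = p (α - 1) / d`. -/
lemma rpow_le_two_mul_mul_memEta (hp : 2 ≤ p) (h1 : 1 < α) {K : ℕ} (hK : 5 ≤ K) :
    (K : ℝ) ^ (p * (α - 1) / memDen p α) ≤ 2 * (K * memEta p α (K - 1)) := by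
  have hd := memDen_pos hp h1
  have hp0 : (0 : ℝ) < p := by positivity
  have hK5 : (5 : ℝ) ≤ K := by exact_mod_cast hK
  have hK0 : (0 : ℝ) < K := by linarith
  set s := (p * α + α - 1) / memDen p α with hs
  have hs1 : s ≤ 1 := by
    rw [hs, div_le_one hd]
    unfold memDen
    nlinarith
  have hs0 : 0 ≤ s := by
    refine div_nonneg ?_ hd.le
    nlinarith
  have hβ : p * (α - 1) / memDen p α = 1 - s := by
    rw [hs, eq_sub_iff_add_eq, ← add_div, div_eq_one_iff_eq hd.ne']
    unfold memDen
    ring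
  have e : ((K - 1 : ℕ) : ℝ) + 4 = K + 3 := by
    rw [Nat.cast_sub (by omega)]
    push_cast
    ring
  rw [hβ, memEta, e, ← hs, Real.rpow_sub hK0, Real.rpow_one]
  have h3 : ((K : ℝ) + 3) ^ s ≤ 2 * (K : ℝ) ^ s := by
    calc ((K : ℝ) + 3) ^ s ≤ (2 * K) ^ s := Real.rpow_le_rpow (by positivity) (by linarith) hs0
      _ = 2 ^ s * (K : ℝ) ^ s := Real.mul_rpow zero_le_two hK0.le
      _ ≤ 2 * (K : ℝ) ^ s := by
          refine mul_le_mul_of_nonneg_right ?_ (by positivity)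
          exact (Real.rpow_le_rpow_of_exponent_le one_le_two hs1).trans (Real.rpow_one 2).le
  rw [mul_one_div, mul_div_assoc', div_le_div_iff₀ (by positivity) (by positivity)]
  nlinarith

/-- The average of the expected gradient norms over the first `K` iterates. -/
lemma average_integral_norm_gradient_le [IsProbabilityMeasure D] [IsProbabilityMeasure P]
    (h : BasicAssumption f G D flow L₁ σ α) (hs : HighSmoothAssumption f p Lp)
    (hξ : ∀ k t, Measurable (ξ k t)) (hlaw : ∀ k t, P.map (ξ k t) = D)
    (hind : iIndepFun (fun k ω t => ξ k t ω) P) {ε : ℝ} (hε0 : 0 < ε) (hε1 : ε < 1) {K : ℕ}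
    (hK : memBound p α (memConst p α σ L₁ Lp (f x0 - flow)) ε ≤ K) :
    ∑ k ∈ Finset.range K, (K : ℝ)⁻¹
        * ∫ ω, ‖gradient f (memTraj G x0 p α (fun k t => ξ k t ω) k).x‖ ∂P ≤ ε := by
  have hp := hs.two_le
  have h1 := h.α_gt_one
  have hK5 : 5 ≤ K := by
    have : (5 : ℝ) ≤ K := (le_max_right _ _).trans hK
    exact_mod_cast this
  have hK0 : (0 : ℝ) < K := by
    have : 0 < K := by omega
    exact_mod_cast this
  have hsum := sum_memEta_mul_integral_norm_gradient_le_memConst (x0 := x0) h hs hξ hlaw hind hK5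
  have hlog := mul_log_le_of_memBound_le hp h1 (memConst_ge h hs) hε0 hε1 hK
  have hη := rpow_le_two_mul_mul_memEta (α := α) hp h1 hK5
  have hη0 := memEta_pos (p := p) (α := α) (K - 1)
  rw [← Finset.mul_sum, inv_mul_le_iff₀ hK0]
  refine le_of_mul_le_mul_left ?_ hη0
  calc memEta p α (K - 1) * ∑ k ∈ Finset.range K,
        ∫ ω, ‖gradient f (memTraj G x0 p α (fun k t => ξ k t ω) k).x‖ ∂P
      ≤ ∑ k ∈ Finset.range K,
        memEta p α k * ∫ ω, ‖gradient f (memTraj G x0 p α (fun k t => ξ k t ω) k).x‖ ∂P := by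
        rw [Finset.mul_sum]
        refine Finset.sum_le_sum fun k hk => mul_le_mul_of_nonneg_right ?_
          (integral_nonneg fun ω => norm_nonneg _)
        exact memEta_antitone hp h1 (by have := Finset.mem_range.1 hk; omega)
    _ ≤ ε * (2 * (K * memEta p α (K - 1))) / 2 := by
        have := mul_le_mul_of_nonneg_left hη hε0.le
        linarith
    _ = _ := by ring

end Convergence

/-! ### The random output index -/

section RandomIndex

lemma measureReal_eq_inv_of_map_eq_uniformOn {Ω : Type*} [MeasurableSpace Ω] {P : Measure Ω}
    {ι : Ω → ℕ} (hι : Measurable ι) {K : ℕ} (hu : P.map ι = uniformOn (Set.Iio K)) {k : ℕ}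
    (hk : k < K) : P.real (ι ⁻¹' {k}) = (K : ℝ)⁻¹ := by
  rw [measureReal_def, ← Measure.map_apply hι (measurableSet_singleton k), hu, uniformOn,
    cond_apply (Set.finite_Iio K).measurableSet, Set.inter_eq_self_of_subset_right
      (Set.singleton_subset_iff.2 (Set.mem_Iio.2 hk)), Measure.count_singleton, mul_one,
    Measure.count_apply_finite _ (Set.finite_Iio K)]
  simp

lemma ae_lt_of_map_eq_uniformOn {Ω : Type*} [MeasurableSpace Ω] {P : Measure Ω}
    {ι : Ω → ℕ} (hι : Measurable ι) {K : ℕ} (hu : P.map ι = uniformOn (Set.Iio K)) :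
    ∀ᵐ ω ∂P, ι ω < K := by
  have : ∀ᵐ k ∂(P.map ι), k < K := by
    rw [hu]
    exact ae_cond_mem (Set.finite_Iio K).measurableSet
  exact ae_of_ae_map hι.aemeasurable this

/-- Evaluating a sequence of functions of `X` at an independent index that is uniform on
`{0, …, K - 1}` averages their expectations. -/
lemma integrable_and_integral_uniform_index {Ω S : Type*} [MeasurableSpace Ω] [MeasurableSpace S]
    {P : Measure Ω} [IsProbabilityMeasure P] {X : Ω → S} (hX : Measurable X) {g : ℕ → S → ℝ}
    (hg : ∀ k, Measurable (g k)) (hgi : ∀ k, Integrable (fun ω => g k (X ω)) P) {ι : Ω → ℕ}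
    (hι : Measurable ι) {K : ℕ} (hu : P.map ι = uniformOn (Set.Iio K)) (hind : IndepFun ι X P) :
    Integrable (fun ω => g (ι ω) (X ω)) P ∧
      ∫ ω, g (ι ω) (X ω) ∂P = ∑ k ∈ Finset.range K, (K : ℝ)⁻¹ * ∫ ω, g k (X ω) ∂P := by
  set i : ℕ → ℕ → ℝ := fun k => Set.indicator {k} 1 with hi
  have him : ∀ k, Measurable (i k) := fun k =>
    measurable_one.indicator (measurableSet_singleton k)
  have hae : (fun ω => g (ι ω) (X ω)) =ᵐ[P]
      fun ω => ∑ k ∈ Finset.range K, i k (ι ω) * g k (X ω) := by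
    filter_upwards [ae_lt_of_map_eq_uniformOn hι hu] with ω hω
    rw [Finset.sum_eq_single_of_mem (ι ω) (Finset.mem_range.2 hω)]
    · simp [hi]
    · intro k _ hk
      simp [hi, Ne.symm hk]
  have hint : ∀ k ∈ Finset.range K, Integrable (fun ω => i k (ι ω) * g k (X ω)) P := fun k _ =>
    (hgi k).bdd_mul (c := 1) ((him k).comp hι).aestronglyMeasurable
      (Filter.Eventually.of_forall fun ω => by
        simp only [hi, Set.indicator_apply]
        split_ifs <;> simp)
  refine ⟨(integrable_finsetSum _ hint).congr hae.symm, ?_⟩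
  rw [integral_congr_ae hae, integral_finsetSum _ hint]
  refine Finset.sum_congr rfl fun k hk => ?_
  have h1 := (hind.comp (him k) (hg k)).integral_fun_mul_eq_mul_integral
    ((him k).comp hι).aestronglyMeasurable ((hg k).comp hX).aestronglyMeasurable
  have h2 : ∫ ω, i k (ι ω) ∂P = (K : ℝ)⁻¹ := by
    rw [← measureReal_eq_inv_of_map_eq_uniformOn hι hu (Finset.mem_range.1 hk),
      ← integral_indicator_one (hι (measurableSet_singleton k))]
    rfl
  simp only [Function.comp_apply] at h1
  rw [h1, h2]

end RandomIndex

/-! ### The parameters are admissible -/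

section Admissible

variable {p : ℕ} {α : ℝ}

lemma memAdmissible_mem (hp : 2 ≤ p) (h1 : 1 < α) :
    MemAdmissible (p - 1) (memEta p α) (memGamma p α) (memTheta p α) where
  one_le := by omega
  η_pos := memEta_pos
  γ_mem k t ht := by
    have hc0 := memBaseGamma_pos (p := p) (α := α) k
    have hc1 := memBaseGamma_lt_one hp h1 k
    have := one_sub_div_sq_mem hc0 hc1 (Finset.mem_Icc.1 ht).1
    have ht0 : (0 : ℝ) < t := by exact_mod_cast (Finset.mem_Icc.1 ht).1
    exact ⟨by unfold memGamma; positivity, by unfold memGamma; linarith⟩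
  θ_sum_mem k := by
    have hc0 := memBaseGamma_pos (p := p) (α := α) k
    have hc1 := memBaseGamma_lt_one hp h1 k
    exact ⟨hc0.trans_le (le_sum_extrapWeight (by omega) hc0 hc1),
      sum_extrapWeight_lt_one (p - 1) hc0 hc1⟩

lemma solvesVandermonde_mem : SolvesVandermonde (p - 1) (memGamma p α) (memTheta p α) := by
  intro k r hr
  refine (Finset.sum_congr rfl fun t _ => ?_).trans
    (sum_extrapWeight_mul_pow (p - 1) (memBaseGamma_pos (p := p) (α := α) k).ne' hr)
  rw [one_div, ← inv_pow, inv_memGamma, mul_comm, memTheta_eq]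

end Admissible

theorem theorem3 {n : ℕ} {Ξ Ω : Type*} [MeasurableSpace Ξ] [MeasurableSpace Ω]
    (f : EuclideanSpace ℝ (Fin n) → ℝ)
    (G : EuclideanSpace ℝ (Fin n) → Ξ → EuclideanSpace ℝ (Fin n))
    (D : Measure Ξ) [IsProbabilityMeasure D] (P : Measure Ω) [IsProbabilityMeasure P]
    (flow L₁ σ α : ℝ) (p : ℕ) (Lp : ℝ)
    (hbasic : BasicAssumption f G D flow L₁ σ α)
    (hsmooth : HighSmoothAssumption f p Lp)
    (x0 : EuclideanSpace ℝ (Fin n))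
    -- `ξ k t` is the sample used for the `t`-th stochastic gradient of iteration `k`. Samples of
    -- different iterations are independent; within one iteration any coupling is allowed, such as
    -- one common sample (`ξ k t = ξ k 1` for all `t`) or independent ones.
    (ξ : ℕ → ℕ → Ω → Ξ)
    (hξ_meas : ∀ k t, Measurable (ξ k t))
    (hξ_law : ∀ k t, P.map (ξ k t) = D)
    (hξ_indep : iIndepFun (fun k ω t => ξ k t ω) P) :
    MemAdmissible (p - 1) (memEta p α) (memGamma p α) (memTheta p α) ∧
    SolvesVandermonde (p - 1) (memGamma p α) (memTheta p α) ∧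
    ∀ ε ∈ Set.Ioo (0 : ℝ) 1, ∀ K : ℕ,
      memBound p α (memConst p α σ L₁ Lp (f x0 - flow)) ε ≤ (K : ℝ) →
      -- `ι` is uniform on `{0, …, K - 1}`, independently of the samples.
      ∀ ι : Ω → ℕ, Measurable ι → P.map ι = uniformOn (Set.Iio K) →
        IndepFun ι (fun ω k t => ξ k t ω) P →
        Integrable (fun ω => ‖gradient f (memIterate G x0 (p - 1) (memEta p α) (memGamma p α)
          (memTheta p α) (fun k t => ξ k t ω) (ι ω))‖) P ∧
        ∫ ω, ‖gradient f (memIterate G x0 (p - 1) (memEta p α) (memGamma p α)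
          (memTheta p α) (fun k t => ξ k t ω) (ι ω))‖ ∂P ≤ ε := by
  refine ⟨memAdmissible_mem hsmooth.two_le hbasic.α_gt_one, solvesVandermonde_mem, ?_⟩
  intro ε hε K hK ι hι hu hind
  have hX : Measurable fun ω (k t : ℕ) => ξ k t ω :=
    measurable_pi_lambda _ fun k => measurable_pi_lambda _ fun t => hξ_meas k t
  have hg : ∀ k, Measurable fun w : ℕ → ℕ → Ξ => ‖gradient f (memTraj G x0 p α w k).x‖ :=
    fun k => measurable_norm_gradient_memTraj (ξ := fun k t (w : ℕ → ℕ → Ξ) => w k t) hbasic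
      (fun k t => (measurable_pi_apply t).comp (measurable_pi_apply k)) k
  have hgi : ∀ k, Integrable
      (fun ω => ‖gradient f (memTraj G x0 p α (fun k t => ξ k t ω) k).x‖) P :=
    fun k => integrable_norm_gradient_memTraj hbasic hξ_meas k
  have key := integrable_and_integral_uniform_index
    (g := fun k w => ‖gradient f (memTraj G x0 p α w k).x‖) hX hg hgi hι hu hind
  unfold memIterate
  refine ⟨key.1, key.2.le.trans ?_⟩
  exact average_integral_norm_gradient_le hbasic hsmooth hξ_meas hξ_law hξ_indep hε.1 hε.2 hK
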